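/- Consider a $K$-armed bandit with mean rewards $\mu_1,\dots,\mu_K\in\mathbb R$, $\mu_\ast=\max_b\mu_b$, sub-optimality gaps $\Delta_a=\mu_\ast-\mu_a\ge 0$ that are not all zero, noise level $\sigma>0$ and horizon $T\ge 1$. In round $t\in\{1,\dots,T\}$ an arm $A_t$ is pulled and the reward $R_t=\mu_{A_t}+\sigma\xi_t$ is received, where $\xi_1,\dots,\xi_T$ are i.i.d. $\mathcal N(0,1)$. The arms are chosen by the UCB1 algorithm with exploration rate $\gamma_T>0$: each arm is pulled once in the first $K$ rounds, and for $t=K+1,\dots,T$, $$A_t\in\arg\max_{a}\Big\{\hat\mu_{a;t-1}+\frac{\sigma\gamma_T}{\sqrt{n_{a;t-1}}}\Big\},\qquad n_{a;t}=\#\{s\le t: A_s=a\},\quad \hat\mu_{a;t}=\frac1{n_{a;t}}\sum_{s\le t,\,A_s=a}R_s .$$ Here $A_t$ depends only on the information available before round $t$ (past rewards and possibly an auxiliary randomization, of which $\xi_t$ is independent); the initial order and the choice between maximizers are otherwise arbitrary. Let $\Theta=(T,K,\Delta,\sigma,\gamma_T)$, let $n_\ast\ge 0$ be the unique solution of $$\sum_{a=1}^K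 n_\ast\Big(1+\frac{n_\ast^{1/2}\Delta_a}{\sigma\gamma_T}\Big)^{-2}=T,$$ and put $$n^\ast_{a;T}=n_\ast\Big(1+\frac{n_\ast^{1/2}\Delta_a}{\sigma\gamma_T}\Big)^{-2},\qquad \mathrm{Reg}^\ast_T(\Theta)=\sum_{a}\Delta_a n^\ast_{a;T},\qquad \hat R^{\mathsf p}(\Theta)=\sum_a\Delta_a n_{a;T},$$ $$\mathrm{err}(\Theta)=\frac{\sqrt{\log\gamma_T}+\sqrt{\log\log T}}{\gamma_T}+\frac KT+\frac{\max_a(\Delta_a/\sigma)^2}{\gamma_T^2}$$ (a square root of a negative or undefined quantity is read as $0$). There exists a universal constant $C>0$ such that in every such model with $\mathrm{err}(\Theta)\le 1/C$, $$\mathbb P\left(\left|\frac{\hat R^{\mathsf p}(\Theta)}{\mathrm{Reg}^\ast_T(\Theta)}-1\right|\ge C\cdot\mathrm{err}(\Theta)\right)\le C\cdot\gamma_T^{-100}.$$ -/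

import Mathlib

open MeasureTheory ProbabilityTheory

namespace UCB

/-- The sub-optimality gaps `Δ a = max_b μ b - μ a` of a bandit with mean rewards `μ`. -/
noncomputable def gap {K : ℕ} (μ : Fin K → ℝ) (a : Fin K) : ℝ := (⨆ b, μ b) - μ a

/-! ### The deterministic theory -/

/-- The noiseless number of pulls of an arm with gap `d`, as a function of `n`:
`n (1 + n^{1/2} d / (σ γ))⁻²`. -/
noncomputable def armCurve (σ γ d n : ℝ) : ℝ := n * ((1 + √n * d / (σ * γ)) ^ 2)⁻¹

/-- `n_*`: the solution `n ≥ 0` of `∑ a, n (1 + n^{1/2} Δ a / (σ γ))⁻² = T`. Existence and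
uniqueness of the solution are proved in `existsUnique_fixedPoint` below, so that the infimum is
taken over a one-point set. -/
noncomputable def nStar {K : ℕ} (T : ℕ) (Δ : Fin K → ℝ) (σ γ : ℝ) : ℝ :=
  sInf {n : ℝ | 0 ≤ n ∧ ∑ a, armCurve σ γ (Δ a) n = T}

/-- `n_{a;T}^* = n_* (1 + n_*^{1/2} Δ a / (σ γ))⁻²`. -/
noncomputable def nArmStar {K : ℕ} (T : ℕ) (Δ : Fin K → ℝ) (σ γ : ℝ) (a : Fin K) : ℝ :=
  armCurve σ γ (Δ a) (nStar T Δ σ γ)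

/-- The theoretical regret `Reg_T^* = ∑ a, Δ a * n_{a;T}^*`. -/
noncomputable def regStar {K : ℕ} (T : ℕ) (Δ : Fin K → ℝ) (σ γ : ℝ) : ℝ :=
  ∑ a, Δ a * nArmStar T Δ σ γ a

/-- The error term
`(√(log γ) + √(log log T)) / γ + K / T + ‖Δ / σ‖_∞² / γ²`
(the norm on `Fin K → ℝ` is the maximum norm). -/
noncomputable def err {K : ℕ} (T : ℕ) (Δ : Fin K → ℝ) (σ γ : ℝ) : ℝ :=
  (√(Real.log γ) + √(Real.log (Real.log T))) / γ + (K : ℝ) / T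
    + ‖fun a => Δ a / σ‖ ^ 2 / γ ^ 2

/-! ### The bandit and the algorithm

Rounds are numbered `1, …, T`. In round `t` the arm `A t` is pulled and the reward
`μ (A t) + σ * ξ t` is received. -/

section Bandit

variable {Ω : Type*} {K : ℕ}

/-- The reward received in round `t`. -/
def reward (μ : Fin K → ℝ) (σ : ℝ) (ξ : ℕ → Ω → ℝ) (A : ℕ → Ω → Fin K) (t : ℕ) (ω : Ω) : ℝ :=
  μ (A t ω) + σ * ξ t ω

/-- `n_{a;t}`: the number of pulls of arm `a` in the rounds `1, …, t`. -/
def pulls (A : ℕ → Ω → Fin K) (a : Fin K) (t : ℕ) (ω : Ω) : ℕ :=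
  ((Finset.Icc 1 t).filter (fun s => A s ω = a)).card

/-- The empirical mean of the rewards of arm `a` in the rounds `1, …, t`. -/
noncomputable def empMean (μ : Fin K → ℝ) (σ : ℝ) (ξ : ℕ → Ω → ℝ) (A : ℕ → Ω → Fin K)
    (a : Fin K) (t : ℕ) (ω : Ω) : ℝ :=
  (∑ s ∈ (Finset.Icc 1 t).filter (fun s => A s ω = a), reward μ σ ξ A s ω) / pulls A a t ω

/-- The index (over-estimated mean) of arm `a` after `t` rounds. -/
noncomputable def ucbIndex (μ : Fin K → ℝ) (σ γ : ℝ) (ξ : ℕ → Ω → ℝ) (A : ℕ → Ω → Fin K)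
    (a : Fin K) (t : ℕ) (ω : Ω) : ℝ :=
  empMean μ σ ξ A a t ω + σ * γ / √(pulls A a t ω : ℝ)

/-- The pseudo-regret over `T` rounds. -/
noncomputable def pseudoRegret (T : ℕ) (μ : Fin K → ℝ) (A : ℕ → Ω → Fin K) (ω : Ω) : ℝ :=
  ∑ a, gap μ a * pulls A a T ω

/-- The noises `ξ 1, …, ξ T` are i.i.d. standard normal. -/
structure IsGaussianNoise [MeasurableSpace Ω] (T : ℕ) (ξ : ℕ → Ω → ℝ) (P : Measure Ω) :
    Prop where
  measurable : ∀ t ∈ Finset.Icc 1 T, Measurable (ξ t)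
  law : ∀ t ∈ Finset.Icc 1 T, P.map (ξ t) = gaussianReal 0 1
  indep : iIndepFun (fun t : Finset.Icc 1 T => ξ t) P

/-- `A` is a run of the `UCB1` algorithm with exploration rate `γ` over `T` rounds.
The filtration `ℱ` is the information on which the choices are based: `ℱ t` contains the noises
of the rounds up to `t`, and beyond these possibly a randomization (of the initial order of the
arms, of the choice between maximizers), but nothing that anticipates the noise of later rounds.
The arm of round `t + 1` is chosen on the basis of `ℱ t`. -/
structure IsUCB1 {mΩ : MeasurableSpace Ω} (T : ℕ) (μ : Fin K → ℝ) (σ γ : ℝ) (ξ : ℕ → Ω → ℝ)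
    (A : ℕ → Ω → Fin K) (ℱ : Filtration ℕ mΩ) (P : Measure Ω) : Prop where
  /-- the noise of a round is known after that round -/
  noise_adapted : ∀ t < T, Measurable[ℱ (t + 1)] (ξ (t + 1))
  /-- the noise of a round is independent of everything known before that round -/
  noise_indep : ∀ t < T, Indep (MeasurableSpace.comap (ξ (t + 1)) inferInstance) (ℱ t) P
  /-- the arm of a round is a function of what is known before that round -/
  arm_predictable : ∀ t < T, Measurable[ℱ t] (A (t + 1))
  /-- each arm is pulled once in the first `K` rounds -/
  init : ∀ ω a, pulls A a K ω = 1
  /-- afterwards an arm with maximal index is pulled -/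
  argmax : ∀ t, K ≤ t → t < T → ∀ ω b,
    ucbIndex μ σ γ ξ A b t ω ≤ ucbIndex μ σ γ ξ A (A (t + 1) ω) t ω

end Bandit

/-! ### The fixed point equation has exactly one solution -/

lemma gap_nonneg {K : ℕ} (μ : Fin K → ℝ) (a : Fin K) : 0 ≤ gap μ a :=
  sub_nonneg.2 (le_ciSup (Set.finite_range μ).bddAbove a)

lemma exists_gap_eq_zero {K : ℕ} (hK : 0 < K) (μ : Fin K → ℝ) : ∃ a, gap μ a = 0 := by
  have : Nonempty (Fin K) := ⟨⟨0, hK⟩⟩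
  obtain ⟨a, ha⟩ := exists_eq_ciSup_of_finite (f := μ)
  exact ⟨a, by simp [gap, ha]⟩

lemma armCurve_strictMonoOn {σ γ d : ℝ} (hσ : 0 < σ) (hγ : 0 < γ) (hd : 0 ≤ d) :
    StrictMonoOn (armCurve σ γ d) (Set.Ici 0) := by
  have hc : 0 ≤ d / (σ * γ) := by positivity
  intro x hx y hy hxy
  have hx0 : (0 : ℝ) ≤ x := hx
  have hy0 : (0 : ℝ) ≤ y := hy
  have key : ∀ z : ℝ, 0 ≤ z → armCurve σ γ d z = (√z / (1 + √z * (d / (σ * γ)))) ^ 2 := by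
    intro z hz
    rw [armCurve, div_pow, Real.sq_sqrt hz, mul_div_assoc, ← div_eq_mul_inv]
  rw [key x hx0, key y hy0]
  have hs : √x < √y := Real.sqrt_lt_sqrt hx0 hxy
  have h1 : 0 < 1 + √x * (d / (σ * γ)) := by positivity
  have h2 : 0 < 1 + √y * (d / (σ * γ)) := by positivity
  refine pow_lt_pow_left₀ ?_ (by positivity) two_ne_zero
  rw [div_lt_div_iff₀ h1 h2]
  nlinarith

lemma armCurve_continuous {σ γ d : ℝ} (hσ : 0 < σ) (hγ : 0 < γ) (hd : 0 ≤ d) :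
    Continuous (armCurve σ γ d) := by
  have h : ∀ n : ℝ, (1 + √n * d / (σ * γ)) ^ 2 ≠ 0 := fun n => by positivity
  unfold armCurve
  exact continuous_id.mul (Continuous.inv₀ (by fun_prop) h)

theorem existsUnique_fixedPoint {K : ℕ} (hK : 0 < K) (T : ℕ) (μ : Fin K → ℝ) {σ γ : ℝ}
    (hσ : 0 < σ) (hγ : 0 < γ) :
    ∃! n : ℝ, 0 ≤ n ∧ ∑ a, armCurve σ γ (gap μ a) n = T := by
  obtain ⟨a₀, ha₀⟩ := exists_gap_eq_zero hK μ
  have hcont : Continuous (fun n : ℝ => ∑ a, armCurve σ γ (gap μ a) n) :=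
    continuous_finsetSum _ fun a _ => armCurve_continuous hσ hγ (gap_nonneg μ a)
  have hmono : StrictMonoOn (fun n : ℝ => ∑ a, armCurve σ γ (gap μ a) n) (Set.Ici 0) := by
    intro x hx y hy hxy
    exact Finset.sum_lt_sum_of_nonempty ⟨a₀, Finset.mem_univ _⟩
      fun a _ => armCurve_strictMonoOn hσ hγ (gap_nonneg μ a) hx hy hxy
  have hT : (0 : ℝ) ≤ T := Nat.cast_nonneg T
  have hend : (T : ℝ) ≤ ∑ a, armCurve σ γ (gap μ a) (T : ℝ) := by
    calc (T : ℝ) = armCurve σ γ (gap μ a₀) (T : ℝ) := by simp [armCurve, ha₀]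
      _ ≤ _ := Finset.single_le_sum (f := fun a => armCurve σ γ (gap μ a) (T : ℝ))
          (fun a _ => by unfold armCurve; positivity) (Finset.mem_univ a₀)
  obtain ⟨n, hn, hnT⟩ := intermediate_value_Icc hT hcont.continuousOn
    (show (T : ℝ) ∈ Set.Icc _ _ from ⟨by simp [armCurve], hend⟩)
  refine ⟨n, ⟨hn.1, hnT⟩, ?_⟩
  rintro m ⟨hm, hmT⟩
  exact hmono.injOn hm hn.1 (hmT.trans hnT.symm)

theorem nStar_spec {K : ℕ} (hK : 0 < K) (T : ℕ) (μ : Fin K → ℝ) {σ γ : ℝ}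
    (hσ : 0 < σ) (hγ : 0 < γ) :
    0 ≤ nStar T (gap μ) σ γ ∧
      ∑ a, armCurve σ γ (gap μ a) (nStar T (gap μ) σ γ) = T := by
  obtain ⟨n, hn, huniq⟩ := existsUnique_fixedPoint hK T μ hσ hγ
  have hset : {n : ℝ | 0 ≤ n ∧ ∑ a, armCurve σ γ (gap μ a) n = T} = {n} :=
    Set.eq_singleton_iff_unique_mem.2 ⟨hn, huniq⟩
  have : nStar T (gap μ) σ γ = n := by rw [nStar, hset, csInf_singleton]
  rw [this]
  exact hn

end UCB

namespace UCB

/-! Divide all gaps by `σ * γ`, write `d a` for the result, and put `lam = 1 / √n_*`. The noiseless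
pull counts become `weight lam (d a) = (lam + d a)⁻²`, and the fixed point equation says that they
sum to `T`.

On a sample path, consider the round after initialization in which the index of the pulled arm is
smallest, and let `V` be this index, centred at the best mean and divided by `σ * γ`. In that round
no arm has an index above `V`, which bounds every count from below; at its own last pull an arm has
index at least `V`, which bounds the count from above (`IsUCB1.exists_level`). Hence the count of
arm `a` is `weight V (d a)` up to one pull and factors `(1 ± z a / γ) ^ 2`, where `z a` is the
largest normalised deviation of the noise of that arm. The counts also sum to `T`, so the levels `V`
and `lam` give nearly equal totals, and Chebyshev's sum inequality turns this into nearly equal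
regrets (`regret_level_bounds`, `abs_regret_sub_le`).

A union bound over the arms is not affordable, since the error term leaves no room for `log K`. Some
arms may therefore deviate by more than `x = 40 (√(log γ) + √(log log T))`; it suffices that they
carry a small share of the pulls and of the regret. Ville's inequality and peeling over dyadic pull
counts give the tail of `z a` (`measure_le_maxDev`), hence a tiny mean for the excess `(1 + z / γ) ^
2` on `z ≥ x` (`lintegral_excess_le`), and Markov's inequality controls weighted sums of the
excesses. The relevant weights depend on the random `V`; this is resolved by controlling all levels
`lam / 2 ^ j` of a logarithmic grid at once (`excessCoeff`, `exists_grid_level`). -/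

/-! ### Deterministic comparison of two levels -/

/-- The noiseless number of pulls of an arm with normalised gap `d` at the normalised level `v`. -/
noncomputable def weight (v d : ℝ) : ℝ := ((v + d) ^ 2)⁻¹

lemma weight_pos {v d : ℝ} (hv : 0 < v) (hd : 0 ≤ d) : 0 < weight v d := by
  unfold weight; positivity

lemma weight_anti {u v d : ℝ} (hu : 0 < u) (huv : u ≤ v) (hd : 0 ≤ d) :
    weight v d ≤ weight u d := by
  unfold weight; gcongr

/-- Since `v + d ≤ 2 * (u + d)`. This lets a grid level within a factor two stand in for the random
level. -/
lemma weight_le_four_mul {u v d : ℝ} (hu : 0 < u) (huv : v ≤ 2 * u) (hv : 0 < v) (hd : 0 ≤ d) :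
    weight u d ≤ 4 * weight v d := by
  unfold weight
  rw [← div_eq_mul_inv, inv_eq_one_div, div_le_div_iff₀ (by positivity) (by positivity)]
  nlinarith

/-- The ratio `weight u d / weight v d = ((v + d) / (u + d)) ^ 2` decreases in `d` when `u ≤ v`;
this monotone ratio is what Chebyshev's inequality needs. -/
lemma weight_mul_weight_le {u v a b : ℝ} (hu : 0 < u) (huv : u ≤ v) (ha : 0 ≤ a) (hab : a ≤ b) :
    weight u b * weight v a ≤ weight u a * weight v b := by
  have hv : 0 < v := hu.trans_le huv
  have hb : 0 ≤ b := ha.trans hab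
  unfold weight
  rw [← mul_inv, ← mul_inv, ← mul_pow, ← mul_pow]
  have : 0 ≤ (v - u) * (b - a) := mul_nonneg (sub_nonneg.2 huv) (sub_nonneg.2 hab)
  gcongr ?_⁻¹
  gcongr ?_ ^ 2
  nlinarith

/-- Lowering the level increases the regret by at most the factor by which it increases the number
of pulls: an instance of Chebyshev's sum inequality. -/
lemma sum_mul_weight_mul_sum_weight_le {ι : Type*} (G : Finset ι) {d : ι → ℝ}
    (hd : ∀ a, 0 ≤ d a) {u v : ℝ} (hu : 0 < u) (huv : u ≤ v) :
    (∑ a ∈ G, d a * weight u (d a)) * ∑ a ∈ G, weight v (d a) ≤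
      (∑ a ∈ G, weight u (d a)) * ∑ a ∈ G, d a * weight v (d a) := by
  rw [← sub_nonneg, Finset.sum_mul_sum, Finset.sum_mul_sum]
  set D := ∑ a ∈ G, ∑ b ∈ G, (d b - d a) * (weight u (d a) * weight v (d b)) with hD
  have h1 : ∑ a ∈ G, ∑ b ∈ G, weight u (d a) * (d b * weight v (d b)) -
      ∑ a ∈ G, ∑ b ∈ G, d a * weight u (d a) * weight v (d b) = D := by
    simp_rw [hD, ← Finset.sum_sub_distrib]
    exact Finset.sum_congr rfl fun a _ => Finset.sum_congr rfl fun b _ => by ring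
  rw [h1]
  -- Symmetrizing in `a` and `b` makes every summand a product of two factors of equal sign.
  have h2 : D + D = ∑ a ∈ G, ∑ b ∈ G,
      (d b - d a) * (weight u (d a) * weight v (d b) - weight u (d b) * weight v (d a)) := by
    conv_lhs => rw [hD]; arg 2; rw [Finset.sum_comm]
    simp_rw [← Finset.sum_add_distrib]
    exact Finset.sum_congr rfl fun a _ => Finset.sum_congr rfl fun b _ => by ring
  have h3 : 0 ≤ D + D := by
    rw [h2]
    refine Finset.sum_nonneg fun a _ => Finset.sum_nonneg fun b _ => ?_
    rcases le_total (d a) (d b) with h | h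
    · exact mul_nonneg (sub_nonneg.2 h)
        (sub_nonneg.2 (weight_mul_weight_le hu huv (hd a) h))
    · exact mul_nonneg_of_nonpos_of_nonpos (sub_nonpos.2 h)
        (sub_nonpos.2 (weight_mul_weight_le hu huv (hd b) h))
  linarith

/-- The regret at level `V` restricted to a set `G` of arms, if the remaining arms are negligible. -/
lemma regret_level_bounds {ι : Type*} (G : Finset ι) {d : ι → ℝ} (hd : ∀ a, 0 ≤ d a)
    {lam V e F : ℝ} (hlam : 0 < lam) (hV : 0 < V) (he : 0 ≤ e) (he' : e ≤ 1 / 20)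
    (hne : G.Nonempty)
    (hFG : ∑ a ∈ G, weight lam (d a) ≤ F) (hG : (1 - e) * F ≤ ∑ a ∈ G, weight lam (d a))
    (hup : (1 - e) ^ 2 * ∑ a ∈ G, weight V (d a) ≤ F)
    (hlow : lam ≤ V → (1 - 2 * e) * F ≤ (1 + e) ^ 2 * ∑ a ∈ G, weight V (d a)) :
    (1 - 4 * e) * ∑ a ∈ G, d a * weight lam (d a) ≤ ∑ a ∈ G, d a * weight V (d a) ∧
      ∑ a ∈ G, d a * weight V (d a) ≤ (1 + 4 * e) * ∑ a ∈ G, d a * weight lam (d a) := by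
  have hFpos : 0 < ∑ a ∈ G, weight lam (d a) :=
    Finset.sum_pos (fun a _ => weight_pos hlam (hd a)) hne
  have hR0 : 0 ≤ ∑ a ∈ G, d a * weight lam (d a) :=
    Finset.sum_nonneg fun a _ => mul_nonneg (hd a) (weight_pos hlam (hd a)).le
  have hmono : ∀ u v : ℝ, 0 < u → u ≤ v →
      ∑ a ∈ G, d a * weight v (d a) ≤ ∑ a ∈ G, d a * weight u (d a) := fun u v hu huv =>
    Finset.sum_le_sum fun a _ => mul_le_mul_of_nonneg_left (weight_anti hu huv (hd a)) (hd a)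
  -- In either case one bound is plain monotonicity in the level; the other is Chebyshev's
  -- inequality combined with the comparison of the total weights.
  rcases le_total V lam with h | h
  · have hch := sum_mul_weight_mul_sum_weight_le G hd hV h
    have hm := hmono V lam hV h
    refine ⟨by nlinarith, ?_⟩
    set FG := ∑ a ∈ G, weight lam (d a)
    set FV := ∑ a ∈ G, weight V (d a)
    set RG := ∑ a ∈ G, d a * weight lam (d a)
    set RV := ∑ a ∈ G, d a * weight V (d a)
    have hFV : FV ≤ (1 + 4 * e) * FG := by
      have h1 : (1 - e) ^ 3 * FV ≤ FG := by
        have := mul_le_mul_of_nonneg_left hup (by linarith : (0 : ℝ) ≤ 1 - e)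
        nlinarith
      have h2 : 1 ≤ (1 + 4 * e) * (1 - e) ^ 3 := by
        have : 0 ≤ e * (1 - 9 * e + 11 * e ^ 2 - 4 * e ^ 3) := by
          apply mul_nonneg he
          have : e ^ 3 ≤ e := by nlinarith [mul_nonneg he he]
          nlinarith [mul_nonneg he he]
        nlinarith
      have h3 : (0 : ℝ) < (1 - e) ^ 3 := by apply pow_pos; linarith
      have h4 : (1 - e) ^ 3 * FV ≤ (1 - e) ^ 3 * ((1 + 4 * e) * FG) := by nlinarith
      exact le_of_mul_le_mul_left h4 h3
    have : RV * FG ≤ (1 + 4 * e) * RG * FG := by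
      nlinarith [mul_le_mul_of_nonneg_right hFV hR0]
    exact le_of_mul_le_mul_right this hFpos
  · have hch := sum_mul_weight_mul_sum_weight_le G hd hlam h
    have hm := hmono lam V hlam h
    have hl := hlow h
    refine ⟨?_, by nlinarith⟩
    set FG := ∑ a ∈ G, weight lam (d a)
    set FV := ∑ a ∈ G, weight V (d a)
    set RG := ∑ a ∈ G, d a * weight lam (d a)
    set RV := ∑ a ∈ G, d a * weight V (d a)
    have hFV : (1 - 4 * e) * FG ≤ FV := by
      have h1 : (1 - 2 * e) * FG ≤ (1 + e) ^ 2 * FV :=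
        (mul_le_mul_of_nonneg_left hFG (by linarith)).trans hl
      have h2 : (1 + e) ^ 2 * (1 - 4 * e) ≤ 1 - 2 * e := by
        nlinarith [mul_nonneg he he, mul_nonneg he (mul_nonneg he he)]
      have h3 : (1 + e) ^ 2 * ((1 - 4 * e) * FG) ≤ (1 + e) ^ 2 * FV := by nlinarith
      exact le_of_mul_le_mul_left h3 (by positivity)
    have : (1 - 4 * e) * RG * FG ≤ RV * FG := by
      nlinarith [mul_le_mul_of_nonneg_right hFV hR0]
    exact le_of_mul_le_mul_right this hFpos

lemma regret_lower_arith {e R RG RV : ℝ} (he' : e ≤ 1 / 20) (hR0 : 0 ≤ R)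
    (hRG : (1 - e) * R ≤ RG) (hlo : (1 - 4 * e) * RG ≤ RV) :
    (1 - 7 * e) * R ≤ (1 - e) ^ 2 * RV := by
  have h1 : (1 - 4 * e) * ((1 - e) * R) ≤ RV :=
    (mul_le_mul_of_nonneg_left hRG (by linarith)).trans hlo
  have h2 : 1 - 7 * e ≤ (1 - e) ^ 2 * ((1 - 4 * e) * (1 - e)) := by
    have : 0 ≤ e ^ 2 * (15 - 13 * e + 4 * e ^ 2) := mul_nonneg (sq_nonneg e) (by nlinarith)
    linarith
  calc (1 - 7 * e) * R ≤ (1 - e) ^ 2 * ((1 - 4 * e) * (1 - e)) * R :=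
        mul_le_mul_of_nonneg_right h2 hR0
    _ = (1 - e) ^ 2 * ((1 - 4 * e) * ((1 - e) * R)) := by ring
    _ ≤ _ := mul_le_mul_of_nonneg_left h1 (sq_nonneg _)

lemma regret_upper_arith {e R RG RV Rv : ℝ} (he : 0 ≤ e) (he' : e ≤ 1 / 20) (hR0 : 0 ≤ R)
    (hRv0 : 0 ≤ Rv) (hRG : RG ≤ R) (hhi : RV ≤ (1 + 4 * e) * RG)
    (hRv : (1 - e) * Rv ≤ (1 + 4 * e) * R) :
    e * R + (1 + e) ^ 2 * RV + 4 * (e * Rv) ≤ R + 14 * e * R := by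
  have h1 : Rv ≤ 51 / 40 * R := by
    have h2 : 19 / 20 * Rv ≤ (1 - e) * Rv := mul_le_mul_of_nonneg_right (by linarith) hRv0
    have h3 : (1 + 4 * e) * R ≤ 6 / 5 * R := mul_le_mul_of_nonneg_right (by linarith) hR0
    linarith
  have h2 : (1 + e) ^ 2 * RV ≤ (1 + 7 * e) * R := by
    have h3 : RV ≤ (1 + 4 * e) * R := hhi.trans (mul_le_mul_of_nonneg_left hRG (by linarith))
    have h4 : (1 + e) ^ 2 * (1 + 4 * e) ≤ 1 + 7 * e := by
      have : 0 ≤ e * (1 - 9 * e - 4 * e ^ 2) := mul_nonneg he (by nlinarith)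
      linarith
    calc (1 + e) ^ 2 * RV ≤ (1 + e) ^ 2 * ((1 + 4 * e) * R) :=
          mul_le_mul_of_nonneg_left h3 (sq_nonneg _)
      _ = (1 + e) ^ 2 * (1 + 4 * e) * R := by ring
      _ ≤ (1 + 7 * e) * R := mul_le_mul_of_nonneg_right h4 hR0
  have h5 := mul_le_mul_of_nonneg_left h1 he
  have h6 := mul_nonneg he hR0
  linarith

/-- The deterministic core: if all but a negligible set of arms are pulled about as often as the
noiseless theory prescribes for some common level `V`, then the regret is close to the
noiseless one. -/
lemma abs_regret_sub_le {ι : Type*} [Fintype ι] [DecidableEq ι] (G : Finset ι) {d y n : ι → ℝ}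
    (hd : ∀ a, 0 ≤ d a) (hy : ∀ a, 0 ≤ y a) (hn : ∀ a, 0 ≤ n a) {lam V e T : ℝ}
    (hlam : 0 < lam) (hV : 0 < V) (he : 0 ≤ e) (he' : e ≤ 1 / 20)
    (hne : G.Nonempty) (hyG : ∀ a ∈ G, y a ≤ e)
    (hT : ∑ a, n a = T) (hF : ∑ a, weight lam (d a) = T)
    (hK : (Fintype.card ι : ℝ) ≤ e * T)
    (hone : ∀ a, 1 ≤ e * weight lam (d a))
    (hup : ∀ a, n a ≤ 1 + (1 + y a) ^ 2 * weight V (d a))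
    (hlow : ∀ a ∈ G, (1 - e) ^ 2 * weight V (d a) ≤ n a)
    (hbadF : ∑ a ∈ Gᶜ, weight lam (d a) * (1 + y a) ^ 2 ≤ e * T)
    (hbadR : ∑ a ∈ Gᶜ, d a * weight lam (d a) * (1 + y a) ^ 2 ≤
      e * ∑ a, d a * weight lam (d a))
    {v : ℝ} (hVv : min V lam ≤ v) (hvV : v ≤ 2 * V)
    (hbadRv : ∑ a ∈ Gᶜ, d a * weight v (d a) * (1 + y a) ^ 2 ≤ e * ∑ a, d a * weight v (d a)) :
    |∑ a, d a * n a - ∑ a, d a * weight lam (d a)| ≤ 14 * e * ∑ a, d a * weight lam (d a) := by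
  have hv0 : 0 < v := (lt_min hV hlam).trans_le hVv
  have hy1 : ∀ a, 1 ≤ (1 + y a) ^ 2 := fun a => by nlinarith [hy a]
  have hsplit : ∀ f : ι → ℝ, ∑ a, f a = ∑ a ∈ G, f a + ∑ a ∈ Gᶜ, f a := fun f =>
    (Finset.sum_add_sum_compl G f).symm
  have hdw : ∀ u : ℝ, 0 < u → ∀ a, 0 ≤ d a * weight u (d a) := fun u hu a =>
    mul_nonneg (hd a) (weight_pos hu (hd a)).le
  -- the weights of the negligible arms
  have hGF : (1 - e) * T ≤ ∑ a ∈ G, weight lam (d a) := by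
    have := hsplit fun a => weight lam (d a)
    have h2 : ∑ a ∈ Gᶜ, weight lam (d a) ≤ ∑ a ∈ Gᶜ, weight lam (d a) * (1 + y a) ^ 2 :=
      Finset.sum_le_sum fun a _ => le_mul_of_one_le_right (weight_pos hlam (hd a)).le (hy1 a)
    linarith
  have hGR : ∀ u : ℝ, 0 < u →
      ∑ a ∈ Gᶜ, d a * weight u (d a) * (1 + y a) ^ 2 ≤ e * ∑ a, d a * weight u (d a) →
      (1 - e) * ∑ a, d a * weight u (d a) ≤ ∑ a ∈ G, d a * weight u (d a) := by
    intro u hu hb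
    have := hsplit fun a => d a * weight u (d a)
    have h2 : ∑ a ∈ Gᶜ, d a * weight u (d a) ≤ ∑ a ∈ Gᶜ, d a * weight u (d a) * (1 + y a) ^ 2 :=
      Finset.sum_le_sum fun a _ => le_mul_of_one_le_right (hdw u hu a) (hy1 a)
    linarith
  have hFG : ∑ a ∈ G, weight lam (d a) ≤ T := by
    rw [← hF, hsplit]
    exact le_add_of_nonneg_right (Finset.sum_nonneg fun a _ => (weight_pos hlam (hd a)).le)
  have hRG : ∑ a ∈ G, d a * weight lam (d a) ≤ ∑ a, d a * weight lam (d a) := by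
    rw [hsplit fun a => d a * weight lam (d a)]
    exact le_add_of_nonneg_right (Finset.sum_nonneg fun a _ => hdw lam hlam a)
  have hupV : (1 - e) ^ 2 * ∑ a ∈ G, weight V (d a) ≤ T := by
    rw [Finset.mul_sum]
    refine (Finset.sum_le_sum hlow).trans ?_
    rw [← hT, hsplit]
    exact le_add_of_nonneg_right (Finset.sum_nonneg fun a _ => hn a)
  have hgood : ∀ a ∈ G, (1 + y a) ^ 2 ≤ (1 + e) ^ 2 := fun a ha => by
    have := hyG a ha
    have := hy a
    gcongr
  have hlowV : lam ≤ V → (1 - 2 * e) * T ≤ (1 + e) ^ 2 * ∑ a ∈ G, weight V (d a) := by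
    -- The two losses `e * T` are the additive one per arm, `K ≤ e * T` in total, and the arms
    -- outside `G`. The latter are controlled only at level `lam`, hence the restriction `lam ≤ V`.
    intro h
    have h1 : T ≤ ∑ a, (1 + (1 + y a) ^ 2 * weight V (d a)) := by
      rw [← hT]; exact Finset.sum_le_sum fun a _ => hup a
    rw [Finset.sum_add_distrib, hsplit fun a => (1 + y a) ^ 2 * weight V (d a)] at h1
    have h2 : ∑ a ∈ G, (1 + y a) ^ 2 * weight V (d a) ≤
        (1 + e) ^ 2 * ∑ a ∈ G, weight V (d a) := by
      rw [Finset.mul_sum]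
      exact Finset.sum_le_sum fun a ha =>
        mul_le_mul_of_nonneg_right (hgood a ha) (weight_pos hV (hd a)).le
    have h3 : ∑ a ∈ Gᶜ, (1 + y a) ^ 2 * weight V (d a) ≤
        ∑ a ∈ Gᶜ, weight lam (d a) * (1 + y a) ^ 2 :=
      Finset.sum_le_sum fun a _ => by
        rw [mul_comm]
        exact mul_le_mul_of_nonneg_right (weight_anti hlam h (hd a)) (sq_nonneg _)
    simp only [Finset.sum_const, Finset.card_univ, nsmul_eq_mul, mul_one] at h1
    linarith
  obtain ⟨hlo, hhi⟩ := regret_level_bounds G hd hlam hV he he' hne hFG hGF hupV hlowV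
  -- the regret of the arms in `G`
  have hGlow : (1 - e) ^ 2 * ∑ a ∈ G, d a * weight V (d a) ≤ ∑ a, d a * n a := by
    rw [hsplit fun a => d a * n a, Finset.mul_sum]
    refine (Finset.sum_le_sum fun a ha => ?_).trans
      (le_add_of_nonneg_right (Finset.sum_nonneg fun a _ => mul_nonneg (hd a) (hn a)))
    calc (1 - e) ^ 2 * (d a * weight V (d a)) = d a * ((1 - e) ^ 2 * weight V (d a)) := by ring
      _ ≤ d a * n a := mul_le_mul_of_nonneg_left (hlow a ha) (hd a)
  have hGup : ∑ a, d a * n a ≤ ∑ a, d a + (1 + e) ^ 2 * ∑ a ∈ G, d a * weight V (d a) +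
      ∑ a ∈ Gᶜ, d a * weight V (d a) * (1 + y a) ^ 2 := by
    have h1 : ∑ a, d a * n a ≤ ∑ a, (d a + d a * weight V (d a) * (1 + y a) ^ 2) :=
      Finset.sum_le_sum fun a _ => by nlinarith [mul_le_mul_of_nonneg_left (hup a) (hd a)]
    rw [Finset.sum_add_distrib, hsplit fun a => d a * weight V (d a) * (1 + y a) ^ 2] at h1
    have h2 : ∑ a ∈ G, d a * weight V (d a) * (1 + y a) ^ 2 ≤
        (1 + e) ^ 2 * ∑ a ∈ G, d a * weight V (d a) := by
      rw [Finset.mul_sum]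
      exact Finset.sum_le_sum fun a ha => by
        rw [mul_comm]
        exact mul_le_mul_of_nonneg_right (hgood a ha) (hdw V hV a)
    linarith
  have hsmall : ∑ a, d a ≤ e * ∑ a, d a * weight lam (d a) := by
    rw [Finset.mul_sum]
    exact Finset.sum_le_sum fun a _ => by nlinarith [mul_le_mul_of_nonneg_left (hone a) (hd a)]
  have hbad : ∑ a ∈ Gᶜ, d a * weight V (d a) * (1 + y a) ^ 2 ≤
      4 * (e * ∑ a, d a * weight v (d a)) := by
    refine le_trans ?_ (mul_le_mul_of_nonneg_left hbadRv (by norm_num))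
    rw [Finset.mul_sum]
    refine Finset.sum_le_sum fun a _ => ?_
    calc d a * weight V (d a) * (1 + y a) ^ 2
        ≤ d a * (4 * weight v (d a)) * (1 + y a) ^ 2 := by
          have := weight_le_four_mul hV hvV hv0 (hd a)
          have := hd a
          gcongr
      _ = _ := by ring
  -- The level `v` lies above `V` or above `lam`, so on `G` its regret is dominated by one of two
  -- quantities already compared with the noiseless regret.
  have hRv : (1 - e) * ∑ a, d a * weight v (d a) ≤
      (1 + 4 * e) * ∑ a, d a * weight lam (d a) := by
    refine (hGR v hv0 hbadRv).trans ?_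
    have hRG0 : 0 ≤ ∑ a ∈ G, d a * weight lam (d a) :=
      Finset.sum_nonneg fun a _ => hdw lam hlam a
    rcases min_le_iff.1 hVv with h | h
    · have : ∑ a ∈ G, d a * weight v (d a) ≤ ∑ a ∈ G, d a * weight V (d a) :=
        Finset.sum_le_sum fun a _ => mul_le_mul_of_nonneg_left (weight_anti hV h (hd a)) (hd a)
      nlinarith
    · have : ∑ a ∈ G, d a * weight v (d a) ≤ ∑ a ∈ G, d a * weight lam (d a) :=
        Finset.sum_le_sum fun a _ => mul_le_mul_of_nonneg_left (weight_anti hlam h (hd a)) (hd a)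
      nlinarith
  have hRG' := hGR lam hlam hbadR
  have hR0 : 0 ≤ ∑ a, d a * weight lam (d a) := Finset.sum_nonneg fun a _ => hdw lam hlam a
  have hRv0 : 0 ≤ ∑ a, d a * weight v (d a) := Finset.sum_nonneg fun a _ => hdw v hv0 a
  rw [abs_le]
  constructor
  · linarith [regret_lower_arith he' hR0 hRG' hlo]
  · linarith [regret_upper_arith he he' hR0 hRv0 hRG hhi hRv, mul_nonneg he hR0]

/-! ### Concentration of the noise of a single arm -/

section Noise

variable {Ω : Type*} {K : ℕ}

/-- The sum of the noises of the pulls of arm `a` in the rounds `1, …, t`. -/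
noncomputable def noiseSum (ξ : ℕ → Ω → ℝ) (A : ℕ → Ω → Fin K) (a : Fin K) (t : ℕ) (ω : Ω) : ℝ :=
  ∑ s ∈ (Finset.Icc 1 t).filter (fun s => A s ω = a), ξ s ω

lemma noiseSum_zero (ξ : ℕ → Ω → ℝ) (A : ℕ → Ω → Fin K) (a : Fin K) (ω : Ω) :
    noiseSum ξ A a 0 ω = 0 := by simp [noiseSum]

lemma noiseSum_succ (ξ : ℕ → Ω → ℝ) (A : ℕ → Ω → Fin K) (a : Fin K) (t : ℕ) (ω : Ω) :
    noiseSum ξ A a (t + 1) ω =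
      noiseSum ξ A a t ω + if A (t + 1) ω = a then ξ (t + 1) ω else 0 := by
  simp only [noiseSum, Finset.sum_filter]
  rw [Finset.sum_Icc_succ_top (by omega)]

lemma pulls_zero (A : ℕ → Ω → Fin K) (a : Fin K) (ω : Ω) : pulls A a 0 ω = 0 := by simp [pulls]

lemma pulls_succ (A : ℕ → Ω → Fin K) (a : Fin K) (t : ℕ) (ω : Ω) :
    pulls A a (t + 1) ω = pulls A a t ω + if A (t + 1) ω = a then 1 else 0 := by
  simp only [pulls, Finset.card_filter]
  rw [Finset.sum_Icc_succ_top (by omega)]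

lemma noiseSum_neg (ξ : ℕ → Ω → ℝ) (A : ℕ → Ω → Fin K) (a : Fin K) (t : ℕ) (ω : Ω) :
    noiseSum (fun s ω => -ξ s ω) A a t ω = -noiseSum ξ A a t ω := by
  simp [noiseSum, Finset.sum_neg_distrib]

/-- The exponential martingale of the noises of arm `a`, stopped at time `T`. -/
noncomputable def expMart (T : ℕ) (ξ : ℕ → Ω → ℝ) (A : ℕ → Ω → Fin K) (a : Fin K) (θ : ℝ)
    (t : ℕ) (ω : Ω) : ℝ :=
  Real.exp (θ * noiseSum ξ A a (min t T) ω - θ ^ 2 / 2 * pulls A a (min t T) ω)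

lemma expMart_zero (T : ℕ) (ξ : ℕ → Ω → ℝ) (A : ℕ → Ω → Fin K) (a : Fin K) (θ : ℝ) :
    expMart T ξ A a θ 0 = fun _ => 1 := by
  funext ω; simp [expMart, noiseSum_zero, pulls_zero]

/-- The increment is split into a factor known before the round and a centred function of the new
noise, the form in which the conditional expectation factorizes. -/
lemma expMart_succ_of_lt {T t : ℕ} (ht : t < T) (ξ : ℕ → Ω → ℝ) (A : ℕ → Ω → Fin K) (a : Fin K)
    (θ : ℝ) : expMart T ξ A a θ (t + 1) = expMart T ξ A a θ t +
      (fun ω => expMart T ξ A a θ t ω * if A (t + 1) ω = a then 1 else 0) *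
        fun ω => Real.exp (θ * ξ (t + 1) ω - θ ^ 2 / 2) - 1 := by
  funext ω
  simp only [expMart, Pi.add_apply, Pi.mul_apply, min_eq_left ht.le,
    min_eq_left (Nat.succ_le_of_lt ht), noiseSum_succ, pulls_succ]
  split_ifs
  · have : θ * (noiseSum ξ A a t ω + ξ (t + 1) ω) - θ ^ 2 / 2 * ((pulls A a t ω + 1 : ℕ) : ℝ) =
      (θ * noiseSum ξ A a t ω - θ ^ 2 / 2 * (pulls A a t ω : ℝ)) +
        (θ * ξ (t + 1) ω - θ ^ 2 / 2) := by push_cast; ring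
    rw [this, Real.exp_add]
    ring
  · simp

lemma expMart_succ_of_le {T t : ℕ} (ht : T ≤ t) (ξ : ℕ → Ω → ℝ) (A : ℕ → Ω → Fin K) (a : Fin K)
    (θ : ℝ) : expMart T ξ A a θ (t + 1) = expMart T ξ A a θ t := by
  funext ω
  simp only [expMart, min_eq_right ht, min_eq_right (ht.trans (Nat.le_succ t))]

/-- What the concentration of the noises of single arms depends on: in every round the noise is
standard normal and independent of the past, on which the choice of the arm is based. -/
structure IsAdaptive {mΩ : MeasurableSpace Ω} (T : ℕ) (ξ : ℕ → Ω → ℝ) (A : ℕ → Ω → Fin K)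
    (ℱ : Filtration ℕ mΩ) (P : Measure Ω) : Prop where
  law : ∀ t < T, P.map (ξ (t + 1)) = gaussianReal 0 1
  noise_adapted : ∀ t < T, Measurable[ℱ (t + 1)] (ξ (t + 1))
  noise_indep : ∀ t < T, Indep (MeasurableSpace.comap (ξ (t + 1)) inferInstance) (ℱ t) P
  arm_predictable : ∀ t < T, Measurable[ℱ t] (A (t + 1))

namespace IsAdaptive

variable {mΩ : MeasurableSpace Ω} {P : Measure Ω} {T : ℕ}
  {ξ : ℕ → Ω → ℝ} {A : ℕ → Ω → Fin K} {ℱ : Filtration ℕ mΩ}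

lemma neg (h : IsAdaptive T ξ A ℱ P) : IsAdaptive T (fun s ω => -ξ s ω) A ℱ P where
  law t ht := by
    have hm : Measurable (ξ (t + 1)) := (h.noise_adapted t ht).mono (ℱ.le _) le_rfl
    have : P.map (fun ω => -ξ (t + 1) ω) = (P.map (ξ (t + 1))).map (fun x => -x) := by
      rw [Measure.map_map measurable_neg hm]; rfl
    rw [this, h.law t ht, gaussianReal_map_neg, neg_zero]
  noise_adapted t ht := (h.noise_adapted t ht).neg
  noise_indep t ht := by
    refine indep_of_indep_of_le_left (h.noise_indep t ht) ?_
    rintro _ ⟨s, hs, rfl⟩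
    exact ⟨(fun x => -x) ⁻¹' s, measurable_neg hs, rfl⟩
  arm_predictable := h.arm_predictable

lemma measurable_ite (h : IsAdaptive T ξ A ℱ P) {t : ℕ} (ht : t < T) (a : Fin K) :
    Measurable[ℱ t] fun ω => if A (t + 1) ω = a then (1 : ℝ) else 0 := by
  have h1 : Measurable fun b : Fin K => if b = a then (1 : ℝ) else 0 := measurable_of_finite _
  exact h1.comp (h.arm_predictable t ht)

lemma measurable_pulls (h : IsAdaptive T ξ A ℱ P) (a : Fin K) {t : ℕ} (ht : t ≤ T) :
    Measurable[ℱ t] fun ω => (pulls A a t ω : ℝ) := by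
  induction t with
  | zero => simp only [pulls_zero]; exact measurable_const
  | succ t ih =>
    simp only [pulls_succ, Nat.cast_add, Nat.cast_ite, Nat.cast_one, Nat.cast_zero]
    exact ((ih (by omega)).mono (ℱ.mono (Nat.le_succ t)) le_rfl).add
      ((h.measurable_ite ht a).mono (ℱ.mono (Nat.le_succ t)) le_rfl)

lemma measurable_noiseSum (h : IsAdaptive T ξ A ℱ P) (a : Fin K) {t : ℕ} (ht : t ≤ T) :
    Measurable[ℱ t] (noiseSum ξ A a t) := by
  induction t with
  | zero =>
    have : noiseSum ξ A a 0 = fun _ => 0 := funext fun ω => noiseSum_zero ξ A a ω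
    rw [this]; exact measurable_const
  | succ t ih =>
    have : noiseSum ξ A a (t + 1) = fun ω => noiseSum ξ A a t ω +
        (if A (t + 1) ω = a then (1 : ℝ) else 0) * ξ (t + 1) ω := by
      funext ω; rw [noiseSum_succ]; split_ifs <;> simp
    rw [this]
    exact ((ih (by omega)).mono (ℱ.mono (Nat.le_succ t)) le_rfl).add
      (((h.measurable_ite ht a).mono (ℱ.mono (Nat.le_succ t)) le_rfl).mul
        (h.noise_adapted t ht))

lemma stronglyMeasurable_expMart (h : IsAdaptive T ξ A ℱ P) (a : Fin K) (θ : ℝ) (t : ℕ) :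
    StronglyMeasurable[ℱ t] (expMart T ξ A a θ t) := by
  have hmin : min t T ≤ T := min_le_right _ _
  have h1 := (h.measurable_noiseSum a hmin).mono (ℱ.mono (min_le_left t T)) le_rfl
  have h2 := (h.measurable_pulls a hmin).mono (ℱ.mono (min_le_left t T)) le_rfl
  exact (((h1.const_mul θ).sub (h2.const_mul (θ ^ 2 / 2))).exp).stronglyMeasurable

lemma stronglyMeasurable_expMart_mul (h : IsAdaptive T ξ A ℱ P) (a : Fin K) (θ : ℝ) {t : ℕ}
    (ht : t < T) : StronglyMeasurable[ℱ t]
      fun ω => expMart T ξ A a θ t ω * if A (t + 1) ω = a then 1 else 0 :=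
  (h.stronglyMeasurable_expMart a θ t).mul (h.measurable_ite ht a).stronglyMeasurable

variable [IsProbabilityMeasure P]

lemma integrable_exp_sub (h : IsAdaptive T ξ A ℱ P) {t : ℕ} (ht : t < T) (θ : ℝ) :
    Integrable (fun ω => Real.exp (θ * ξ (t + 1) ω - θ ^ 2 / 2) - 1) P := by
  have hm : Measurable (ξ (t + 1)) := (h.noise_adapted t ht).mono (ℱ.le _) le_rfl
  have h1 : Integrable (fun x => Real.exp (θ * x)) (P.map (ξ (t + 1))) := by
    rw [h.law t ht]; exact integrable_exp_mul_gaussianReal θ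
  have h2 : Integrable (fun ω => Real.exp (θ * ξ (t + 1) ω)) P :=
    h1.comp_measurable hm
  simp_rw [Real.exp_sub]
  exact (h2.div_const _).sub (integrable_const _)

lemma integral_exp_sub (h : IsAdaptive T ξ A ℱ P) {t : ℕ} (ht : t < T) (θ : ℝ) :
    ∫ ω, (Real.exp (θ * ξ (t + 1) ω - θ ^ 2 / 2) - 1) ∂P = 0 := by
  have hm : Measurable (ξ (t + 1)) := (h.noise_adapted t ht).mono (ℱ.le _) le_rfl
  have hmgf : ∫ ω, Real.exp (θ * ξ (t + 1) ω) ∂P = Real.exp (θ ^ 2 / 2) := by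
    have := mgf_gaussianReal (h.law t ht) θ
    simpa [mgf] using this
  have hi := h.integrable_exp_sub ht θ
  have h1 : Integrable (fun ω => Real.exp (θ * ξ (t + 1) ω - θ ^ 2 / 2)) P :=
    (hi.add (integrable_const (1 : ℝ))).congr (.of_forall fun ω => by simp)
  rw [integral_sub h1 (integrable_const _)]
  simp_rw [Real.exp_sub]
  rw [integral_div, hmgf]
  simp

/-- The two factors are independent, so integrability of each suffices; no boundedness is required.
-/
lemma integrable_expMart_increment (h : IsAdaptive T ξ A ℱ P) (a : Fin K) (θ : ℝ) {t : ℕ}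
    (ht : t < T) (hi : Integrable (expMart T ξ A a θ t) P) :
    Integrable ((fun ω => expMart T ξ A a θ t ω * if A (t + 1) ω = a then 1 else 0) *
        fun ω => Real.exp (θ * ξ (t + 1) ω - θ ^ 2 / 2) - 1) P := by
  have hsm := h.stronglyMeasurable_expMart_mul a θ ht
  have hi1 : Integrable (fun ω => expMart T ξ A a θ t ω * if A (t + 1) ω = a then 1 else 0) P := by
    refine hi.mono (hsm.mono (ℱ.le t)).aestronglyMeasurable (.of_forall fun ω => ?_)
    rw [norm_mul]
    refine mul_le_of_le_one_right (norm_nonneg _) ?_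
    split_ifs <;> simp
  refine IndepFun.integrable_mul ?_ hi1 (h.integrable_exp_sub ht θ)
  refine (indep_of_indep_of_le_left (indep_of_indep_of_le_right (h.noise_indep t ht)
    hsm.measurable.comap_le) ?_).symm
  have hu : Measurable fun x : ℝ => Real.exp (θ * x - θ ^ 2 / 2) - 1 := by fun_prop
  rintro _ ⟨s, hs, rfl⟩
  exact ⟨_, hu hs, rfl⟩

lemma integrable_expMart (h : IsAdaptive T ξ A ℱ P) (a : Fin K) (θ : ℝ) (t : ℕ) :
    Integrable (expMart T ξ A a θ t) P := by
  induction t with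
  | zero => rw [expMart_zero]; exact integrable_const _
  | succ t ih =>
    rcases lt_or_ge t T with ht | ht
    · rw [expMart_succ_of_lt ht]
      exact ih.add (h.integrable_expMart_increment a θ ht ih)
    · rwa [expMart_succ_of_le ht]

lemma martingale_expMart (h : IsAdaptive T ξ A ℱ P) (a : Fin K) (θ : ℝ) :
    Martingale (expMart T ξ A a θ) ℱ P := by
  refine martingale_of_condExp_sub_eq_zero_nat (h.stronglyMeasurable_expMart a θ)
    (h.integrable_expMart a θ) fun t => ?_
  rcases lt_or_ge t T with ht | ht
  · rw [expMart_succ_of_lt ht, add_sub_cancel_left]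
    refine (condExp_mul_of_stronglyMeasurable_left (h.stronglyMeasurable_expMart_mul a θ ht)
      (h.integrable_expMart_increment a θ ht (h.integrable_expMart a θ t))
      (h.integrable_exp_sub ht θ)).trans ?_
    have hm : Measurable (ξ (t + 1)) := (h.noise_adapted t ht).mono (ℱ.le _) le_rfl
    have hu : Measurable fun x : ℝ => Real.exp (θ * x - θ ^ 2 / 2) - 1 := by fun_prop
    have hsm : StronglyMeasurable[MeasurableSpace.comap (ξ (t + 1)) inferInstance]
        fun ω => Real.exp (θ * ξ (t + 1) ω - θ ^ 2 / 2) - 1 :=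
      (hu.comp (comap_measurable (ξ (t + 1)))).stronglyMeasurable
    have := condExp_indep_eq hm.comap_le (ℱ.le t) hsm (h.noise_indep t ht)
    rw [h.integral_exp_sub ht θ] at this
    filter_upwards [this] with ω hω
    simp [hω]
  · rw [expMart_succ_of_le ht, sub_self, condExp_zero]

lemma integral_expMart (h : IsAdaptive T ξ A ℱ P) (a : Fin K) (θ : ℝ) (t : ℕ) :
    ∫ ω, expMart T ξ A a θ t ω ∂P = 1 := by
  have := (h.martingale_expMart a θ).setIntegral_eq (Nat.zero_le t) MeasurableSet.univ
  simp only [Measure.restrict_univ] at this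
  rw [← this, expMart_zero]
  simp

/-- Ville's inequality for the exponential martingale. -/
lemma measure_exists_le_expMart (h : IsAdaptive T ξ A ℱ P) (a : Fin K) (θ : ℝ) {x : ℝ} :
    P {ω | ∃ t ≤ T, x ≤ θ * noiseSum ξ A a t ω - θ ^ 2 / 2 * pulls A a t ω} ≤
      ENNReal.ofReal (Real.exp (-x)) := by
  have hmax := maximal_ineq (h.martingale_expMart a θ).submartingale
    (fun t ω => (Real.exp_pos _).le) (ε := (Real.exp x).toNNReal) T
  set E := {ω | (((Real.exp x).toNNReal : NNReal) : ℝ) ≤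
    (Finset.range (T + 1)).sup' Finset.nonempty_range_add_one fun k => expMart T ξ A a θ k ω}
  have hsub : {ω | ∃ t ≤ T, x ≤ θ * noiseSum ξ A a t ω - θ ^ 2 / 2 * pulls A a t ω} ⊆ E := by
    rintro ω ⟨t, ht, hx⟩
    simp only [E, Set.mem_ofPred_eq, Real.coe_toNNReal _ (Real.exp_pos x).le]
    refine le_trans ?_ (Finset.le_sup' (fun k => expMart T ξ A a θ k ω)
      (Finset.mem_range.2 (Nat.lt_succ_of_le ht)))
    simp only [expMart, min_eq_left ht]
    exact Real.exp_le_exp.2 hx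
  have hint : ∫ ω in E, expMart T ξ A a θ T ω ∂P ≤ 1 := by
    rw [← h.integral_expMart a θ T]
    exact setIntegral_le_integral (h.integrable_expMart a θ T)
      (.of_forall fun ω => (Real.exp_pos _).le)
  have h1 : ((Real.exp x).toNNReal : ENNReal) * P E ≤ 1 := by
    refine hmax.trans ?_
    rw [← ENNReal.ofReal_one]
    exact ENNReal.ofReal_le_ofReal hint
  refine (measure_mono hsub).trans ?_
  rw [Real.exp_neg, ENNReal.ofReal_inv_of_pos (Real.exp_pos x)]
  rw [ENNReal.le_inv_iff_mul_le, mul_comm]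
  exact h1

end IsAdaptive
/-- The largest normalised deviation `|∑ ξ| / √n` of arm `a` in the rounds up to `T`. -/
noncomputable def maxDev (T : ℕ) (ξ : ℕ → Ω → ℝ) (A : ℕ → Ω → Fin K) (a : Fin K) (ω : Ω) : ℝ :=
  (Finset.range (T + 1)).sup' Finset.nonempty_range_add_one
    fun t => |noiseSum ξ A a t ω| / √(pulls A a t ω : ℝ)

lemma le_maxDev {T t : ℕ} (ht : t ≤ T) (ξ : ℕ → Ω → ℝ) (A : ℕ → Ω → Fin K) (a : Fin K) (ω : Ω) :
    |noiseSum ξ A a t ω| / √(pulls A a t ω : ℝ) ≤ maxDev T ξ A a ω :=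
  Finset.le_sup' (fun t => |noiseSum ξ A a t ω| / √(pulls A a t ω : ℝ))
    (Finset.mem_range.2 (Nat.lt_succ_of_le ht))

lemma maxDev_nonneg (T : ℕ) (ξ : ℕ → Ω → ℝ) (A : ℕ → Ω → Fin K) (a : Fin K) (ω : Ω) :
    0 ≤ maxDev T ξ A a ω :=
  le_trans (by positivity) (le_maxDev le_rfl ξ A a ω)

/-- The tilt `y / (2 q)` detects a deviation `S ≥ y m` for all `m` between `q` and `√2 q`. -/
lemma peeling_bound {y q m S : ℝ} (hy : 0 < y) (hq : 0 < q) (hqm : q ≤ m) (hm : m ^ 2 ≤ 2 * q ^ 2)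
    (hS : y * m ≤ S) : y ^ 2 / 4 ≤ y / (2 * q) * S - (y / (2 * q)) ^ 2 / 2 * m ^ 2 := by
  have h1 : y / (2 * q) * (y * m) ≤ y / (2 * q) * S :=
    mul_le_mul_of_nonneg_left hS (by positivity)
  have h2 : y / (2 * q) * (y * q) ≤ y / (2 * q) * (y * m) := by gcongr
  have h3 : y / (2 * q) * (y * q) = y ^ 2 / 2 := by field_simp
  have h4 : (y / (2 * q)) ^ 2 / 2 * m ^ 2 ≤ (y / (2 * q)) ^ 2 / 2 * (2 * q ^ 2) := by gcongr
  have h5 : (y / (2 * q)) ^ 2 / 2 * (2 * q ^ 2) = y ^ 2 / 4 := by field_simp; norm_num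
  linarith

/-- The scale `i` is the binary logarithm of the pull count at the deviating time. As the count is
at most `T`, only logarithmically many tilts are needed, the source of `log log T` in the error. -/
lemma exists_dyadic_of_le_maxDev {T : ℕ} {ξ : ℕ → Ω → ℝ} {A : ℕ → Ω → Fin K} {a : Fin K} {ω : Ω}
    {y : ℝ} (hy : 0 < y) (h : y ≤ maxDev T ξ A a ω) :
    ∃ i ∈ Finset.range (Nat.log 2 T + 1), ∃ t ≤ T,
      y ^ 2 / 4 ≤ y / (2 * √(2 ^ i)) * |noiseSum ξ A a t ω| -
        (y / (2 * √(2 ^ i))) ^ 2 / 2 * pulls A a t ω := by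
  obtain ⟨t, ht, hyt⟩ := (Finset.le_sup'_iff _).1 h
  have htT : t ≤ T := Nat.lt_succ_iff.1 (Finset.mem_range.1 ht)
  set n := pulls A a t ω with hn
  -- Without pulls the normalised deviation is a division by zero, hence `0 < y`.
  have hn0 : n ≠ 0 := by
    rintro h0
    simp only [h0, Nat.cast_zero, Real.sqrt_zero, div_zero] at hyt
    linarith
  have hnT : n ≤ T := by
    refine le_trans ?_ htT
    rw [hn, pulls]
    exact (Finset.card_filter_le _ _).trans (by simp)
  have hm : 0 < √(n : ℝ) := Real.sqrt_pos.2 (by positivity)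
  refine ⟨Nat.log 2 n, Finset.mem_range.2 (Nat.lt_succ_of_le (Nat.log_mono_right hnT)), t, htT, ?_⟩
  have h1 : ((2 : ℝ) ^ Nat.log 2 n) ≤ n := by exact_mod_cast Nat.pow_log_le_self 2 hn0
  have h2 : (n : ℝ) ≤ 2 * 2 ^ Nat.log 2 n := by
    have := (Nat.lt_pow_succ_log_self (b := 2) (by norm_num) n).le
    rw [pow_succ] at this
    rw [mul_comm]
    exact_mod_cast this
  have hsq : √(n : ℝ) ^ 2 = n := Real.sq_sqrt (Nat.cast_nonneg n)
  have := peeling_bound (S := |noiseSum ξ A a t ω|) hy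
    (Real.sqrt_pos.2 (by positivity : (0 : ℝ) < 2 ^ Nat.log 2 n)) (Real.sqrt_le_sqrt h1)
    (by rw [hsq, Real.sq_sqrt (by positivity)]; exact h2) ((le_div_iff₀ hm).1 hyt)
  rwa [hsq] at this

namespace IsAdaptive

variable {mΩ : MeasurableSpace Ω} {P : Measure Ω} {T : ℕ}
  {ξ : ℕ → Ω → ℝ} {A : ℕ → Ω → Fin K} {ℱ : Filtration ℕ mΩ}

lemma measurable_maxDev (h : IsAdaptive T ξ A ℱ P) (a : Fin K) : Measurable (maxDev T ξ A a) := by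
  unfold maxDev
  have : Measurable ((Finset.range (T + 1)).sup' Finset.nonempty_range_add_one
      fun t ω => |noiseSum ξ A a t ω| / √(pulls A a t ω : ℝ)) := by
    refine Finset.measurable_sup' _ fun t ht => ?_
    have ht : t ≤ T := Nat.lt_succ_iff.1 (Finset.mem_range.1 ht)
    have h1 := (h.measurable_noiseSum a ht).mono (ℱ.le t) le_rfl
    have h2 := (h.measurable_pulls a ht).mono (ℱ.le t) le_rfl
    exact h1.abs.div h2.sqrt
  convert this using 1
  funext ω
  rw [Finset.sup'_apply]

variable [IsProbabilityMeasure P]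

/-- Ville's inequality for each dyadic scale and, through the sign-flipped noise, for each sign. -/
lemma measure_le_maxDev (h : IsAdaptive T ξ A ℱ P) (a : Fin K) {y : ℝ} (hy : 0 < y) :
    P {ω | y ≤ maxDev T ξ A a ω} ≤
      ENNReal.ofReal (2 * (Nat.log 2 T + 1 : ℕ) * Real.exp (-(y ^ 2 / 4))) := by
  set θ : ℕ → ℝ := fun i => y / (2 * √(2 ^ i)) with hθ
  set E : (ℕ → Ω → ℝ) → ℕ → Set Ω := fun ξ i =>
    {ω | ∃ t ≤ T, y ^ 2 / 4 ≤ θ i * noiseSum ξ A a t ω - θ i ^ 2 / 2 * pulls A a t ω} with hE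
  have hsub : {ω | y ≤ maxDev T ξ A a ω} ⊆
      ⋃ i ∈ Finset.range (Nat.log 2 T + 1), (E ξ i ∪ E (fun s ω => -ξ s ω) i) := by
    intro ω hω
    obtain ⟨i, hi, t, ht, hit⟩ := exists_dyadic_of_le_maxDev hy hω
    simp only [Set.mem_iUnion]
    refine ⟨i, hi, ?_⟩
    rcases abs_cases (noiseSum ξ A a t ω) with ⟨h1, -⟩ | ⟨h1, -⟩
    · left; exact ⟨t, ht, by rwa [h1] at hit⟩
    · right; exact ⟨t, ht, by rw [noiseSum_neg]; rwa [h1] at hit⟩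
  have hone : ∀ i, P (E ξ i ∪ E (fun s ω => -ξ s ω) i) ≤
      ENNReal.ofReal (2 * Real.exp (-(y ^ 2 / 4))) := fun i => by
    refine (measure_union_le _ _).trans ((add_le_add (h.measure_exists_le_expMart a (θ i))
      (h.neg.measure_exists_le_expMart a (θ i))).trans_eq ?_)
    rw [← ENNReal.ofReal_add (Real.exp_pos _).le (Real.exp_pos _).le, two_mul]
  refine (measure_mono hsub).trans ((measure_biUnion_finset_le _ _).trans
    ((Finset.sum_le_sum fun i _ => hone i).trans_eq ?_))
  rw [Finset.sum_const, Finset.card_range, nsmul_eq_mul, ← ENNReal.ofReal_natCast,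
    ← ENNReal.ofReal_mul (Nat.cast_nonneg _)]
  congr 1
  ring

end IsAdaptive

/-! ### Mean excess of an arm with large deviations -/

/-- The factor by which the number of pulls of an arm with large deviations may exceed the
noiseless one; zero for an arm whose deviations stay below `x`. -/
noncomputable def excess (γ x z : ℝ) : ℝ := if x ≤ z then (1 + z / γ) ^ 2 else 0

lemma excess_nonneg (γ x z : ℝ) : 0 ≤ excess γ x z := by
  unfold excess; split_ifs <;> positivity

lemma measurable_excess (γ x : ℝ) : Measurable (excess γ x) := by
  unfold excess
  exact Measurable.ite measurableSet_Ici (by fun_prop) measurable_const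

lemma exists_excess_le {γ x z : ℝ} (hγ : 1 ≤ γ) (hx : 1 ≤ x) (hz : x ≤ z) :
    ∃ k : ℕ, x * 2 ^ k ≤ z ∧ excess γ x z ≤ 16 * 4 ^ k * x ^ 2 := by
  have hx0 : 0 < x := by linarith
  obtain ⟨k, hk1, hk2⟩ := exists_nat_pow_near ((one_le_div hx0).2 hz) one_lt_two
  refine ⟨k, by rwa [le_div_iff₀ hx0, mul_comm] at hk1, ?_⟩
  rw [div_lt_iff₀ hx0] at hk2
  have hz1 : 1 ≤ z := hx.trans hz
  rw [excess, if_pos hz]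
  have h1 : z / γ ≤ z := div_le_self (by linarith) hγ
  have h2 : 0 ≤ z / γ := by positivity
  calc (1 + z / γ) ^ 2 ≤ (2 * (2 ^ (k + 1) * x)) ^ 2 := by
        gcongr; linarith
    _ = 16 * (2 ^ 2) ^ k * x ^ 2 := by rw [← pow_mul, mul_comm 2 k, pow_mul]; ring
    _ = 16 * 4 ^ k * x ^ 2 := by norm_num

lemma excess_tail_term_le {x L : ℝ} (hx : 4 ≤ x) (hL : 0 ≤ L) (k : ℕ) :
    16 * 4 ^ k * x ^ 2 * (2 * L * Real.exp (-((x * 2 ^ k) ^ 2 / 4))) ≤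
      256 * L * Real.exp (-(x ^ 2 / 8)) * (1 / 2) ^ k := by
  set u := x ^ 2 * 4 ^ k with hu
  have hu2 : (x * 2 ^ k) ^ 2 = u := by
    rw [hu, mul_pow, ← pow_mul, mul_comm k 2, pow_mul]; norm_num
  have hu0 : 0 ≤ u := by positivity
  have h1 : u * Real.exp (-(u / 4)) ≤ 8 * Real.exp (-(u / 8)) := by
    have h2 : u / 8 ≤ Real.exp (u / 8) := by linarith [Real.add_one_le_exp (u / 8)]
    have h3 : Real.exp (-(u / 4)) = Real.exp (-(u / 8)) * Real.exp (-(u / 8)) := by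
      rw [← Real.exp_add]; congr 1; ring
    have h4 : Real.exp (u / 8) * Real.exp (-(u / 8)) = 1 := by
      rw [← Real.exp_add]; simp
    have h5 := mul_le_mul_of_nonneg_right h2
      (mul_nonneg (Real.exp_pos (-(u / 8))).le (Real.exp_pos (-(u / 8))).le)
    rw [← mul_assoc (Real.exp (u / 8)), h4, one_mul] at h5
    rw [h3]
    linarith
  have h6 : Real.exp (-(u / 8)) ≤ Real.exp (-(x ^ 2 / 8)) * (1 / 2) ^ k := by
    have h7 : (1 + k : ℝ) ≤ 4 ^ k := by
      have := one_add_mul_le_pow (a := (3 : ℝ)) (by norm_num) k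
      norm_num at this
      have hk : (0 : ℝ) ≤ k := Nat.cast_nonneg k
      linarith
    have h8 : x ^ 2 / 8 + k * 2 ≤ u / 8 := by
      have h9 : x ^ 2 * (1 + k) ≤ u := mul_le_mul_of_nonneg_left h7 (sq_nonneg x)
      have h10 : (16 : ℝ) * k ≤ x ^ 2 * k := by gcongr; nlinarith
      linarith
    have h11 : Real.exp (-2) ≤ 1 / 2 := by
      rw [Real.exp_neg, one_div]
      gcongr
      linarith [Real.add_one_le_exp (2 : ℝ)]
    calc Real.exp (-(u / 8)) ≤ Real.exp (-(x ^ 2 / 8) + k * (-2)) :=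
          Real.exp_le_exp.2 (by linarith)
      _ = Real.exp (-(x ^ 2 / 8)) * Real.exp (-2) ^ k := by rw [Real.exp_add, Real.exp_nat_mul]
      _ ≤ _ := by gcongr
  rw [hu2]
  calc 16 * 4 ^ k * x ^ 2 * (2 * L * Real.exp (-(u / 4)))
      = 32 * L * (u * Real.exp (-(u / 4))) := by rw [hu]; ring
    _ ≤ 32 * L * (8 * (Real.exp (-(x ^ 2 / 8)) * (1 / 2) ^ k)) := by
        refine mul_le_mul_of_nonneg_left (h1.trans ?_) (by positivity)
        linarith
    _ = _ := by ring

lemma IsAdaptive.lintegral_excess_le {mΩ : MeasurableSpace Ω} {P : Measure Ω}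
    [IsProbabilityMeasure P] {T : ℕ} {ξ : ℕ → Ω → ℝ} {A : ℕ → Ω → Fin K} {ℱ : Filtration ℕ mΩ}
    (h : IsAdaptive T ξ A ℱ P) (a : Fin K) {γ x : ℝ} (hγ : 1 ≤ γ) (hx : 4 ≤ x) :
    ∫⁻ ω, ENNReal.ofReal (excess γ x (maxDev T ξ A a ω)) ∂P ≤
      ENNReal.ofReal (512 * (Nat.log 2 T + 1 : ℕ) * Real.exp (-(x ^ 2 / 8))) := by
  set L : ℝ := ((Nat.log 2 T + 1 : ℕ) : ℝ) with hL
  have hL0 : 0 ≤ L := Nat.cast_nonneg _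
  set E : ℕ → Set Ω := fun k => {ω | x * 2 ^ k ≤ maxDev T ξ A a ω} with hE
  have hEm : ∀ k, MeasurableSet (E k) := fun k =>
    measurableSet_le measurable_const (h.measurable_maxDev a)
  set c : ℕ → ENNReal := fun k => ENNReal.ofReal (16 * 4 ^ k * x ^ 2) with hc
  have hpt : ∀ ω, ENNReal.ofReal (excess γ x (maxDev T ξ A a ω)) ≤
      ∑' k, (E k).indicator (fun _ => c k) ω := fun ω => by
    by_cases hz : x ≤ maxDev T ξ A a ω
    · obtain ⟨k, hk1, hk2⟩ := exists_excess_le hγ (by linarith) hz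
      refine le_trans ?_ (ENNReal.le_tsum k)
      rw [Set.indicator_of_mem (show ω ∈ E k from hk1)]
      exact ENNReal.ofReal_le_ofReal hk2
    · simp [excess, hz]
  have hsum : HasSum (fun k : ℕ => 256 * L * Real.exp (-(x ^ 2 / 8)) * (1 / 2) ^ k)
      (512 * L * Real.exp (-(x ^ 2 / 8))) := by
    have := hasSum_geometric_two.mul_left (256 * L * Real.exp (-(x ^ 2 / 8)))
    rwa [show 256 * L * Real.exp (-(x ^ 2 / 8)) * 2 = 512 * L * Real.exp (-(x ^ 2 / 8)) by ring]
      at this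
  calc ∫⁻ ω, ENNReal.ofReal (excess γ x (maxDev T ξ A a ω)) ∂P
      ≤ ∫⁻ ω, ∑' k, (E k).indicator (fun _ => c k) ω ∂P := lintegral_mono hpt
    _ = ∑' k, c k * P (E k) := by
        rw [lintegral_tsum fun k => (measurable_const.indicator (hEm k)).aemeasurable]
        exact tsum_congr fun k => by rw [lintegral_indicator_const (hEm k)]
    _ ≤ ∑' k : ℕ, ENNReal.ofReal (256 * L * Real.exp (-(x ^ 2 / 8)) * (1 / 2) ^ k) := by
        refine ENNReal.tsum_le_tsum fun k => ?_
        refine (mul_le_mul_right (h.measure_le_maxDev a (by positivity)) _).trans ?_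
        rw [hc, ← ENNReal.ofReal_mul (by positivity)]
        exact ENNReal.ofReal_le_ofReal (excess_tail_term_le hx hL0 k)
    _ = ENNReal.ofReal (512 * L * Real.exp (-(x ^ 2 / 8))) := by
        rw [← hsum.tsum_eq, ENNReal.ofReal_tsum_of_nonneg (fun k => by positivity) hsum.summable]

end Noise

/-! ### Pull counts along a sample path -/

section Path
variable {Ω : Type*} {K : ℕ}

lemma pulls_mono (A : ℕ → Ω → Fin K) (a : Fin K) (ω : Ω) : Monotone fun t => pulls A a t ω :=
  monotone_nat_of_le_succ fun t => by rw [pulls_succ]; exact Nat.le_add_right _ _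

lemma sum_pulls (A : ℕ → Ω → Fin K) (t : ℕ) (ω : Ω) : ∑ a, pulls A a t ω = t := by
  induction t with
  | zero => simp [pulls_zero]
  | succ t ih => simp [pulls_succ, Finset.sum_add_distrib, ih]

lemma exists_last_pull {A : ℕ → Ω → Fin K} {a : Fin K} {ω : Ω} {t₀ : ℕ}
    (h0 : pulls A a t₀ ω = 1) {t : ℕ} (ht : t₀ ≤ t) :
    pulls A a t ω = 1 ∨
      ∃ s, t₀ ≤ s ∧ s < t ∧ A (s + 1) ω = a ∧ pulls A a s ω + 1 = pulls A a t ω := by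
  induction t, ht using Nat.le_induction with
  | base => exact Or.inl h0
  | succ t ht ih =>
    by_cases hA : A (t + 1) ω = a
    · exact Or.inr ⟨t, ht, Nat.lt_succ_self t, hA, by rw [pulls_succ, if_pos hA]⟩
    · rw [pulls_succ, if_neg hA, add_zero]
      rcases ih with h | ⟨s, h1, h2, h3, h4⟩
      · exact Or.inl h
      · exact Or.inr ⟨s, h1, h2.trans (Nat.lt_succ_self t), h3, h4⟩

/-- In normalised units the index plus the gap is `(1 + deviation / γ) / √n`, so bounds on the index
are bounds on the pull count. -/
lemma ucbIndex_eq {μ : Fin K → ℝ} {σ γ : ℝ} (hσ : 0 < σ) (hγ : 0 < γ) (ξ : ℕ → Ω → ℝ)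
    {A : ℕ → Ω → Fin K} {a : Fin K} {t : ℕ} {ω : Ω} (hn : pulls A a t ω ≠ 0) :
    (ucbIndex μ σ γ ξ A a t ω - ⨆ b, μ b) / (σ * γ) + gap μ a / (σ * γ) =
      (1 + noiseSum ξ A a t ω / √(pulls A a t ω : ℝ) / γ) / √(pulls A a t ω : ℝ) := by
  have hsum : ∑ s ∈ (Finset.Icc 1 t).filter (fun s => A s ω = a), reward μ σ ξ A s ω =
      pulls A a t ω * μ a + σ * noiseSum ξ A a t ω := by
    have h1 : ∀ s ∈ (Finset.Icc 1 t).filter (fun s => A s ω = a),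
        reward μ σ ξ A s ω = μ a + σ * ξ s ω := fun s hs => by
      rw [reward, (Finset.mem_filter.1 hs).2]
    rw [Finset.sum_congr rfl h1, Finset.sum_add_distrib, noiseSum, Finset.mul_sum, Finset.sum_const,
      nsmul_eq_mul, pulls]
  have hn' : (0 : ℝ) < pulls A a t ω := by positivity
  have hs : 0 < √(pulls A a t ω : ℝ) := Real.sqrt_pos.2 hn'
  rw [ucbIndex, empMean, hsum, gap]
  set n : ℝ := (pulls A a t ω : ℝ)
  have hsq : √n * √n = n := Real.mul_self_sqrt hn'.le
  have h2 : (n * μ a + σ * noiseSum ξ A a t ω) / n =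
      μ a + σ * (noiseSum ξ A a t ω / √n / √n) := by
    rw [div_div, hsq]; field_simp
  rw [h2]
  field_simp
  ring

lemma abs_noiseSum_div_le {T t : ℕ} (ht : t ≤ T) {γ : ℝ} (hγ : 0 < γ) (ξ : ℕ → Ω → ℝ)
    (A : ℕ → Ω → Fin K) (a : Fin K) (ω : Ω) :
    |noiseSum ξ A a t ω / √(pulls A a t ω : ℝ) / γ| ≤ maxDev T ξ A a ω / γ := by
  rw [abs_div, abs_div, abs_of_nonneg (Real.sqrt_nonneg _), abs_of_pos hγ]
  have := le_maxDev ht ξ A a ω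
  gcongr

/-- There is a common level `V` to which the indices of all arms are balanced. -/
lemma IsUCB1.exists_level {mΩ : MeasurableSpace Ω} {P : Measure Ω} {T : ℕ} {μ : Fin K → ℝ}
    {σ γ : ℝ} {ξ : ℕ → Ω → ℝ} {A : ℕ → Ω → Fin K} {ℱ : Filtration ℕ mΩ}
    (h : IsUCB1 T μ σ γ ξ A ℱ P) (hσ : 0 < σ) (hγ : 0 < γ) (hK : K < T) (ω : Ω) :
    ∃ V : ℝ, ∀ a,
      (pulls A a T ω = 1 ∨ ∃ m : ℕ, m ≠ 0 ∧ m + 1 = pulls A a T ω ∧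
        V + gap μ a / (σ * γ) ≤ (1 + maxDev T ξ A a ω / γ) / √(m : ℝ)) ∧
      ∃ m : ℕ, m ≠ 0 ∧ m ≤ pulls A a T ω ∧
        (1 - maxDev T ξ A a ω / γ) / √(m : ℝ) ≤ V + gap μ a / (σ * γ) := by
  -- The critical round: the pulled arm has the maximal index, and this maximum is smallest over
  -- time.
  obtain ⟨s, hs, hmin⟩ := Finset.exists_min_image (Finset.Ico K T)
    (fun t => ucbIndex μ σ γ ξ A (A (t + 1) ω) t ω) ⟨K, Finset.mem_Ico.2 ⟨le_rfl, hK⟩⟩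
  rw [Finset.mem_Ico] at hs
  have hpos : ∀ a t, K ≤ t → pulls A a t ω ≠ 0 := fun a t ht => by
    have := pulls_mono A a ω ht
    simp only [h.init] at this
    omega
  have hσγ : 0 < σ * γ := mul_pos hσ hγ
  refine ⟨(ucbIndex μ σ γ ξ A (A (s + 1) ω) s ω - ⨆ b, μ b) / (σ * γ), fun a => ⟨?_, ?_⟩⟩
  · rcases exists_last_pull (h.init ω a) hK.le with h1 | ⟨t, h1, h2, h3, h4⟩
    · exact Or.inl h1
    · refine Or.inr ⟨pulls A a t ω, hpos a t h1, h4, ?_⟩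
      have h5 := hmin t (Finset.mem_Ico.2 ⟨h1, h2⟩)
      rw [h3] at h5
      calc _ ≤ (ucbIndex μ σ γ ξ A a t ω - ⨆ b, μ b) / (σ * γ) + gap μ a / (σ * γ) := by gcongr
        _ = _ := ucbIndex_eq hσ hγ ξ (hpos a t h1)
        _ ≤ _ := by
          have := (abs_le.1 (abs_noiseSum_div_le h2.le hγ ξ A a ω)).2
          gcongr
  · refine ⟨pulls A a s ω, hpos a s hs.1, pulls_mono A a ω hs.2.le, ?_⟩
    calc _ ≤ (1 + noiseSum ξ A a s ω / √(pulls A a s ω : ℝ) / γ) / √(pulls A a s ω : ℝ) := by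
          have := (abs_le.1 (abs_noiseSum_div_le hs.2.le hγ ξ A a ω)).1
          gcongr
          linarith
      _ = (ucbIndex μ σ γ ξ A a s ω - ⨆ b, μ b) / (σ * γ) + gap μ a / (σ * γ) :=
          (ucbIndex_eq hσ hγ ξ (hpos a s hs.1)).symm
      _ ≤ _ := by
          have := h.argmax s hs.1 hs.2 ω a
          gcongr

/-- The index inequality holds just before the last pull, with `m = n - 1`; that last pull is the
additive one. -/
lemma le_one_add_mul_weight {V d y : ℝ} {n : ℕ} (hV : 0 < V) (hd : 0 ≤ d)
    (h : n = 1 ∨ ∃ m : ℕ, m ≠ 0 ∧ m + 1 = n ∧ V + d ≤ (1 + y) / √(m : ℝ)) :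
    (n : ℝ) ≤ 1 + (1 + y) ^ 2 * weight V d := by
  rcases h with rfl | ⟨m, hm, rfl, h⟩
  · have := weight_pos hV hd
    push_cast
    nlinarith [sq_nonneg (1 + y)]
  · have hm' : (0 : ℝ) < m := by positivity
    rw [le_div_iff₀ (Real.sqrt_pos.2 hm')] at h
    have h2 := pow_le_pow_left₀ (by positivity) h 2
    rw [mul_pow, Real.sq_sqrt hm'.le] at h2
    have : (m : ℝ) ≤ (1 + y) ^ 2 * weight V d := by
      rw [weight, ← div_eq_mul_inv, le_div_iff₀ (by positivity)]
      linarith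
    push_cast
    linarith

lemma level_lower {x y e : ℝ} {n : ℕ} (hye : y ≤ e) (he : e ≤ 1)
    (h : ∃ m : ℕ, m ≠ 0 ∧ m ≤ n ∧ (1 - y) / √(m : ℝ) ≤ x) : (1 - e) / √(n : ℝ) ≤ x := by
  obtain ⟨m, hm, hmn, h⟩ := h
  have hm' : (0 : ℝ) < m := by positivity
  refine le_trans ?_ h
  have := Real.sqrt_pos.2 hm'
  have : (m : ℝ) ≤ n := by exact_mod_cast hmn
  gcongr
  linarith

lemma mul_weight_le_of_level {V d e : ℝ} {n : ℕ} (hn : n ≠ 0) (hV : 0 < V) (hd : 0 ≤ d)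
    (he : e ≤ 1) (h : (1 - e) / √(n : ℝ) ≤ V + d) : (1 - e) ^ 2 * weight V d ≤ n := by
  have hn' : (0 : ℝ) < n := by positivity
  rw [div_le_iff₀ (Real.sqrt_pos.2 hn')] at h
  have h2 := pow_le_pow_left₀ (by linarith) h 2
  rw [mul_pow, Real.sq_sqrt hn'.le] at h2
  rw [weight, ← div_eq_mul_inv, div_le_iff₀ (by positivity)]
  linarith

end Path

/-! ### Grid of levels and the normalised fixed point -/

/-- A dyadic grid below `lam` meets `[V, 2 V]`, with logarithmically many levels. -/
lemma exists_grid_level {lam V : ℝ} {T : ℕ} (hV : 0 < V)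
    (h : lam ^ 2 ≤ V ^ 2 * T) :
    ∃ j ∈ Finset.range (Nat.log 2 T + 1), min V lam ≤ lam / 2 ^ j ∧ lam / 2 ^ j ≤ 2 * V := by
  rcases le_total lam V with hl | hl
  · exact ⟨0, by simp, by simp, by simp; linarith⟩
  · obtain ⟨j, h1, h2⟩ := exists_nat_pow_near ((one_le_div hV).2 hl) one_lt_two
    refine ⟨j, ?_, ?_, ?_⟩
    · rw [Finset.mem_range]
      refine Nat.lt_succ_of_le (Nat.le_log_of_pow_le (by norm_num) ?_)
      -- The hypothesis even gives `4 ^ j ≤ T`; the cruder `2 ^ j ≤ T` is enough.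
      have h3 : (2 : ℝ) ^ j ≤ (2 ^ j) ^ 2 := by
        have : (1 : ℝ) ≤ 2 ^ j := one_le_pow₀ (by norm_num)
        nlinarith
      have h4 : ((2 : ℝ) ^ j) ^ 2 ≤ T := by
        refine (pow_le_pow_left₀ (by positivity) h1 2).trans ?_
        rw [div_pow, div_le_iff₀ (by positivity)]
        linarith
      exact_mod_cast h3.trans h4
    · refine min_le_of_left_le ?_
      rw [le_div_iff₀ hV] at h1
      rw [le_div_iff₀ (by positivity)]
      linarith
    · rw [div_lt_iff₀ hV, pow_succ] at h2
      rw [div_le_iff₀ (by positivity)]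
      linarith

section Fixed
variable {K T : ℕ} {μ : Fin K → ℝ} {σ γ : ℝ}

/-- The normalised level `1 / √n_*` of the noiseless theory. -/
noncomputable def levelStar (T : ℕ) (μ : Fin K → ℝ) (σ γ : ℝ) : ℝ :=
  (√(nStar T (gap μ) σ γ))⁻¹

lemma nStar_pos (hK : 0 < K) (hT : 0 < T) (μ : Fin K → ℝ) (hσ : 0 < σ) (hγ : 0 < γ) :
    0 < nStar T (gap μ) σ γ := by
  obtain ⟨h0, h1⟩ := nStar_spec hK T μ hσ hγ
  refine lt_of_le_of_ne h0 fun h => ?_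
  rw [← h] at h1
  simp only [armCurve, zero_mul, Finset.sum_const_zero] at h1
  exact hT.ne (by exact_mod_cast h1)

lemma levelStar_pos (hK : 0 < K) (hT : 0 < T) (μ : Fin K → ℝ) (hσ : 0 < σ) (hγ : 0 < γ) :
    0 < levelStar T μ σ γ := inv_pos.2 (Real.sqrt_pos.2 (nStar_pos hK hT μ hσ hγ))

lemma nArmStar_eq (hK : 0 < K) (hT : 0 < T) (μ : Fin K → ℝ) (hσ : 0 < σ) (hγ : 0 < γ)
    (a : Fin K) :
    nArmStar T (gap μ) σ γ a = weight (levelStar T μ σ γ) (gap μ a / (σ * γ)) := by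
  have h := nStar_pos hK hT μ hσ hγ
  have hs := Real.sqrt_pos.2 h
  rw [nArmStar, armCurve, levelStar, weight]
  set n := nStar T (gap μ) σ γ
  have hn : n = √n ^ 2 := (Real.sq_sqrt h.le).symm
  have hd : 0 ≤ gap μ a / (σ * γ) := div_nonneg (gap_nonneg μ a) (by positivity)
  have h1 : (√n)⁻¹ + gap μ a / (σ * γ) = (1 + √n * gap μ a / (σ * γ)) / √n := by
    field_simp
  rw [h1, div_pow, inv_div, ← hn, div_eq_mul_inv n]

lemma sum_weight_levelStar (hK : 0 < K) (hT : 0 < T) (μ : Fin K → ℝ) (hσ : 0 < σ) (hγ : 0 < γ) :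
    ∑ a, weight (levelStar T μ σ γ) (gap μ a / (σ * γ)) = T := by
  rw [← (nStar_spec hK T μ hσ hγ).2]
  exact Finset.sum_congr rfl fun a _ => (nArmStar_eq hK hT μ hσ hγ a).symm

lemma regStar_eq (hK : 0 < K) (hT : 0 < T) (μ : Fin K → ℝ) (hσ : 0 < σ) (hγ : 0 < γ) :
    regStar T (gap μ) σ γ = σ * γ *
      ∑ a, gap μ a / (σ * γ) * weight (levelStar T μ σ γ) (gap μ a / (σ * γ)) := by
  rw [regStar, Finset.mul_sum]
  refine Finset.sum_congr rfl fun a _ => ?_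
  rw [nArmStar_eq hK hT μ hσ hγ]
  field_simp

lemma pseudoRegret_eq {Ω : Type*} (hσ : 0 < σ) (hγ : 0 < γ) (A : ℕ → Ω → Fin K) (ω : Ω) :
    pseudoRegret T μ A ω = σ * γ * ∑ a, gap μ a / (σ * γ) * pulls A a T ω := by
  rw [pseudoRegret, Finset.mul_sum]
  refine Finset.sum_congr rfl fun a _ => ?_
  field_simp

/-- Dropping the gaps increases each of the `K` weights to `1 / lam ^ 2`, while their sum is `T`. -/
lemma levelStar_sq_le (hK : 0 < K) (hT : 0 < T) (μ : Fin K → ℝ) (hσ : 0 < σ) (hγ : 0 < γ) :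
    levelStar T μ σ γ ^ 2 ≤ K / T := by
  have hl := levelStar_pos hK hT μ hσ hγ
  have h := sum_weight_levelStar hK hT μ hσ hγ
  have h1 : ∑ a, weight (levelStar T μ σ γ) (gap μ a / (σ * γ)) ≤
      ∑ _a : Fin K, (levelStar T μ σ γ ^ 2)⁻¹ :=
    Finset.sum_le_sum fun a _ => by
      have hd : 0 ≤ gap μ a / (σ * γ) := div_nonneg (gap_nonneg μ a) (by positivity)
      unfold weight
      gcongr
      linarith
  rw [h, Finset.sum_const, Finset.card_univ, Fintype.card_fin, nsmul_eq_mul, ← div_eq_mul_inv,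
    le_div_iff₀ (by positivity)] at h1
  rw [le_div_iff₀ (by positivity)]
  linarith

lemma normGap_sq_le (μ : Fin K → ℝ) (σ γ : ℝ) (a : Fin K) :
    (gap μ a / (σ * γ)) ^ 2 ≤ ‖fun a => gap μ a / σ‖ ^ 2 / γ ^ 2 := by
  have h := norm_le_pi_norm (fun a => gap μ a / σ) a
  have h2 := pow_le_pow_left₀ (norm_nonneg _) h 2
  rw [Real.norm_eq_abs, sq_abs] at h2
  rw [← div_div, div_pow _ γ]
  gcongr

/-- By `(lam + d) ^ 2 ≤ 2 * (lam ^ 2 + d ^ 2)`. Here the terms `K / T` and `max (Δ / σ) ^ 2 / γ ^ 2`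
of the error enter: they make a single pull negligible for every arm. -/
lemma one_le_mul_weight_levelStar (hK : 0 < K) (hT : 0 < T) (μ : Fin K → ℝ) (hσ : 0 < σ)
    (hγ : 0 < γ) (a : Fin K) :
    1 ≤ 2 * ((K : ℝ) / T + ‖fun a => gap μ a / σ‖ ^ 2 / γ ^ 2) *
      weight (levelStar T μ σ γ) (gap μ a / (σ * γ)) := by
  have h1 := levelStar_sq_le hK hT μ hσ hγ
  have h2 := normGap_sq_le μ σ γ a
  have h3 := levelStar_pos hK hT μ hσ hγ
  have hd : 0 ≤ gap μ a / (σ * γ) := div_nonneg (gap_nonneg μ a) (by positivity)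
  rw [weight, ← div_eq_mul_inv, one_le_div (by positivity)]
  nlinarith [sq_nonneg (levelStar T μ σ γ - gap μ a / (σ * γ))]

end Fixed

lemma IsUCB1.isAdaptive {Ω : Type*} {K : ℕ} {mΩ : MeasurableSpace Ω} {P : Measure Ω} {T : ℕ}
    {μ : Fin K → ℝ} {σ γ : ℝ} {ξ : ℕ → Ω → ℝ} {A : ℕ → Ω → Fin K} {ℱ : Filtration ℕ mΩ}
    (h : IsUCB1 T μ σ γ ξ A ℱ P) (hξ : IsGaussianNoise T ξ P) : IsAdaptive T ξ A ℱ P where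
  law t ht := hξ.law (t + 1) (Finset.mem_Icc.2 ⟨by omega, ht⟩)
  noise_adapted := h.noise_adapted
  noise_indep := h.noise_indep
  arm_predictable := h.arm_predictable

/-! ### Weighted excesses of the arms -/

/-- The coefficients of the weighted sum of the excesses of the arms that controls the influence
of the arms with large deviations at all levels `lam / 2 ^ j`, `j < L`. -/
noncomputable def excessCoeff {K : ℕ} (d : Fin K → ℝ) (lam : ℝ) (L : ℕ) (a₀ a : Fin K) : ℝ :=
  ∑ j ∈ Finset.range L, d a * weight (lam / 2 ^ j) (d a) / (∑ b, d b * weight (lam / 2 ^ j) (d b)) +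
    weight lam (d a) / (∑ b, weight lam (d b)) + if a = a₀ then 1 else 0

section Coeff
variable {K : ℕ} {d : Fin K → ℝ} {lam : ℝ}

lemma regret_term_nonneg (hd : ∀ a, 0 ≤ d a) (hlam : 0 < lam) (j : ℕ) (a : Fin K) :
    0 ≤ d a * weight (lam / 2 ^ j) (d a) / ∑ b, d b * weight (lam / 2 ^ j) (d b) := by
  have h : ∀ b, 0 ≤ d b * weight (lam / 2 ^ j) (d b) := fun b =>
    mul_nonneg (hd b) (weight_pos (by positivity) (hd b)).le
  exact div_nonneg (h a) (Finset.sum_nonneg fun b _ => h b)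

lemma pulls_term_nonneg (hd : ∀ a, 0 ≤ d a) (hlam : 0 < lam) (a : Fin K) :
    0 ≤ weight lam (d a) / ∑ b, weight lam (d b) :=
  div_nonneg (weight_pos hlam (hd a)).le (Finset.sum_nonneg fun b _ => (weight_pos hlam (hd b)).le)

lemma regret_term_le_excessCoeff (hd : ∀ a, 0 ≤ d a) (hlam : 0 < lam) {L j : ℕ}
    (hj : j ∈ Finset.range L) (a₀ a : Fin K) :
    d a * weight (lam / 2 ^ j) (d a) / (∑ b, d b * weight (lam / 2 ^ j) (d b)) ≤
      excessCoeff d lam L a₀ a := by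
  have h1 := Finset.single_le_sum (f := fun j => d a * weight (lam / 2 ^ j) (d a) /
    ∑ b, d b * weight (lam / 2 ^ j) (d b)) (fun j _ => regret_term_nonneg hd hlam j a) hj
  have h2 := pulls_term_nonneg hd hlam a
  have h3 : (0 : ℝ) ≤ if a = a₀ then 1 else 0 := by split_ifs <;> norm_num
  simp only [excessCoeff] at *
  linarith

lemma pulls_term_le_excessCoeff (hd : ∀ a, 0 ≤ d a) (hlam : 0 < lam) (L : ℕ) (a₀ a : Fin K) :
    weight lam (d a) / (∑ b, weight lam (d b)) ≤ excessCoeff d lam L a₀ a := by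
  have h1 := Finset.sum_nonneg fun j (_ : j ∈ Finset.range L) => regret_term_nonneg hd hlam j a
  have h3 : (0 : ℝ) ≤ if a = a₀ then 1 else 0 := by split_ifs <;> norm_num
  simp only [excessCoeff] at *
  linarith

lemma excessCoeff_nonneg (hd : ∀ a, 0 ≤ d a) (hlam : 0 < lam) (L : ℕ) (a₀ a : Fin K) :
    0 ≤ excessCoeff d lam L a₀ a :=
  (pulls_term_nonneg hd hlam a).trans (pulls_term_le_excessCoeff hd hlam L a₀ a)

lemma one_le_excessCoeff_self (hd : ∀ a, 0 ≤ d a) (hlam : 0 < lam) (L : ℕ) (a₀ : Fin K) :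
    1 ≤ excessCoeff d lam L a₀ a₀ := by
  have h1 := Finset.sum_nonneg fun j (_ : j ∈ Finset.range L) => regret_term_nonneg hd hlam j a₀
  have h2 := pulls_term_nonneg hd hlam a₀
  simp only [excessCoeff, if_true] at *
  linarith

/-- Each normalised family has total at most one: `L` regret levels, the pull counts, and the
indicator of `a₀`. -/
lemma sum_excessCoeff_le (d : Fin K → ℝ) (lam : ℝ) (L : ℕ) (a₀ : Fin K) :
    ∑ a, excessCoeff d lam L a₀ a ≤ L + 2 := by
  simp only [excessCoeff, Finset.sum_add_distrib, Finset.sum_ite_eq', Finset.mem_univ, if_true]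
  rw [Finset.sum_comm]
  have h1 : ∑ j ∈ Finset.range L, ∑ a, d a * weight (lam / 2 ^ j) (d a) /
      (∑ b, d b * weight (lam / 2 ^ j) (d b)) ≤ ∑ j ∈ Finset.range L, (1 : ℝ) :=
    Finset.sum_le_sum fun j _ => by rw [← Finset.sum_div]; exact div_self_le_one _
  have h2 : ∑ a, weight lam (d a) / (∑ b, weight lam (d b)) ≤ 1 := by
    rw [← Finset.sum_div]; exact div_self_le_one _
  simp only [Finset.sum_const, Finset.card_range, nsmul_eq_mul, mul_one] at h1
  linarith

/-- If a coefficient is dominated by the normalised `f`, then so is the share of the arms with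
large deviations in the sum of `f`. -/
lemma sum_bad_le {c f z : Fin K → ℝ} {γ x e : ℝ} (hc : ∀ a, f a / ∑ b, f b ≤ c a)
    (hc0 : ∀ a, 0 ≤ c a) (hf : 0 < ∑ b, f b) (hW : ∑ a, c a * excess γ x (z a) ≤ e) :
    ∑ a ∈ (Finset.univ.filter fun a => z a < x)ᶜ, f a * (1 + z a / γ) ^ 2 ≤ e * ∑ b, f b := by
  rw [← div_le_iff₀ hf, Finset.sum_div]
  refine le_trans ?_ hW
  refine (Finset.sum_le_sum fun a ha => ?_).trans (Finset.sum_le_sum_of_subset_of_nonneg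
    (Finset.subset_univ _) fun a _ _ => mul_nonneg (hc0 a) (excess_nonneg γ x (z a)))
  have hx : x ≤ z a := by simpa using ha
  rw [excess, if_pos hx, mul_div_right_comm]
  exact mul_le_mul_of_nonneg_right (hc a) (sq_nonneg _)

end Coeff

/-! ### Assembly and probability of failure -/

/-- On the event that the arms with large deviations have small weight, the regret is close to the
noiseless one. -/
lemma IsUCB1.abs_regret_div_sub_one_le {Ω : Type*} {K : ℕ} {mΩ : MeasurableSpace Ω} {P : Measure Ω}
    {T : ℕ} {μ : Fin K → ℝ} {σ γ : ℝ} {ξ : ℕ → Ω → ℝ} {A : ℕ → Ω → Fin K} {ℱ : Filtration ℕ mΩ}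
    (h : IsUCB1 T μ σ γ ξ A ℱ P) (hσ : 0 < σ) (hγ : 0 < γ) (hT : 0 < T)
    (hgap : ∃ a, 0 < gap μ a) {a₀ : Fin K} (ha₀ : gap μ a₀ = 0) {e x : ℝ}
    (he' : e ≤ 1 / 20) (hx : x / γ ≤ e)
    (hsmall : 2 * ((K : ℝ) / T + ‖fun a => gap μ a / σ‖ ^ 2 / γ ^ 2) ≤ e) {ω : Ω}
    (hW : ∑ a, excessCoeff (fun a => gap μ a / (σ * γ)) (levelStar T μ σ γ) (Nat.log 2 T + 1) a₀ a *
      excess γ x (maxDev T ξ A a ω) ≤ e) :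
    |pseudoRegret T μ A ω / regStar T (gap μ) σ γ - 1| ≤ 14 * e := by
  have hK : 0 < K := a₀.pos
  have hTr : (0 : ℝ) < T := by exact_mod_cast hT
  have hσγ : 0 < σ * γ := mul_pos hσ hγ
  set d : Fin K → ℝ := fun a => gap μ a / (σ * γ) with hd_def
  set lam := levelStar T μ σ γ with hlam_def
  set z : Fin K → ℝ := fun a => maxDev T ξ A a ω with hz_def
  have hd : ∀ a, 0 ≤ d a := fun a => div_nonneg (gap_nonneg μ a) hσγ.le
  have hlam : 0 < lam := levelStar_pos hK hT μ hσ hγ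
  have hz : ∀ a, 0 ≤ z a := fun a => maxDev_nonneg T ξ A a ω
  have hF : ∑ a, weight lam (d a) = T := sum_weight_levelStar hK hT μ hσ hγ
  have hnorm : 0 ≤ ‖fun a => gap μ a / σ‖ ^ 2 / γ ^ 2 := by positivity
  have hKT : 0 ≤ (K : ℝ) / T := by positivity
  have he : 0 ≤ e := by linarith
  have hKe : (K : ℝ) ≤ e * T := by rw [← div_le_iff₀ hTr]; linarith
  have hK4 : (K : ℝ) / T ≤ 1 / 4 := by linarith
  have hKlt : K < T := by
    have : (K : ℝ) < T := by nlinarith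
    exact_mod_cast this
  have hn0 : ∀ a, pulls A a T ω ≠ 0 := fun a => by
    have := pulls_mono A a ω hKlt.le
    simp only [h.init] at this
    omega
  have hRpos : ∀ v : ℝ, 0 < v → 0 < ∑ a, d a * weight v (d a) := fun v hv => by
    obtain ⟨a, ha⟩ := hgap
    refine Finset.sum_pos' (fun a _ => mul_nonneg (hd a) (weight_pos hv (hd a)).le)
      ⟨a, Finset.mem_univ a, mul_pos (div_pos ha hσγ) (weight_pos hv (hd a))⟩
  have hc0 := excessCoeff_nonneg hd hlam (Nat.log 2 T + 1) a₀
  -- The indicator in the coefficients serves here: a large deviation of the optimal arm alone would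
  -- push the weighted sum to at least one.
  have hz0 : z a₀ < x := by
    by_contra hcon
    have h1 : 1 ≤ excess γ x (z a₀) := by
      rw [excess, if_pos (not_lt.1 hcon)]
      have : 0 ≤ z a₀ / γ := div_nonneg (hz a₀) hγ.le
      nlinarith
    have h2 := Finset.single_le_sum
      (f := fun a => excessCoeff d lam (Nat.log 2 T + 1) a₀ a * excess γ x (z a))
      (fun a _ => mul_nonneg (hc0 a) (excess_nonneg γ x (z a))) (Finset.mem_univ a₀)
    have h3 := one_le_excessCoeff_self hd hlam (Nat.log 2 T + 1) a₀
    have h4 : 1 ≤ excessCoeff d lam (Nat.log 2 T + 1) a₀ a₀ * excess γ x (z a₀) :=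
      one_le_mul_of_one_le_of_one_le h3 h1
    have h5 := h2.trans hW
    linarith
  have hgood : ∀ a, z a < x → z a / γ ≤ e := fun a ha =>
    le_trans (by gcongr) hx
  obtain ⟨V, hVall⟩ := h.exists_level hσ hγ hKlt ω
  have hlower : ∀ a, z a < x → (1 - e) / √(pulls A a T ω : ℝ) ≤ V + d a := fun a ha =>
    level_lower (hgood a ha) (by linarith) (hVall a).2
  -- The optimal arm has gap zero and at most `T` pulls, so its lower count bound keeps `V` away
  -- from zero. This makes the grid finite.
  have hVT : 1 / 2 ≤ V * √(T : ℝ) := by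
    have h1 := hlower a₀ hz0
    have hda₀ : d a₀ = 0 := by simp [hd_def, ha₀]
    have hpos : (0 : ℝ) < pulls A a₀ T ω := by
      have := hn0 a₀
      positivity
    rw [hda₀, add_zero, div_le_iff₀ (Real.sqrt_pos.2 hpos)] at h1
    have h2 : (pulls A a₀ T ω : ℝ) ≤ T := by
      exact_mod_cast (Finset.single_le_sum (f := fun a => pulls A a T ω)
        (fun a _ => Nat.zero_le _) (Finset.mem_univ a₀)).trans_eq (sum_pulls A T ω)
    have hV0 : 0 < V := by
      by_contra hcon
      have := mul_nonneg (sub_nonneg.2 (not_lt.1 hcon)) (Real.sqrt_nonneg (pulls A a₀ T ω : ℝ))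
      linarith
    have h3 : V * √(pulls A a₀ T ω : ℝ) ≤ V * √(T : ℝ) := by gcongr
    linarith
  have hV : 0 < V := by
    by_contra hcon
    have := mul_nonneg (sub_nonneg.2 (not_lt.1 hcon)) (Real.sqrt_nonneg (T : ℝ))
    linarith
  have hlamV : lam ^ 2 ≤ V ^ 2 * T := by
    have h1 : lam ^ 2 ≤ K / T := levelStar_sq_le hK hT μ hσ hγ
    have h2 := pow_le_pow_left₀ (by norm_num) hVT 2
    rw [mul_pow, Real.sq_sqrt hTr.le] at h2
    linarith
  obtain ⟨j, hj, hj1, hj2⟩ := exists_grid_level hV hlamV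
  have hbadR : ∀ j ∈ Finset.range (Nat.log 2 T + 1),
      ∑ a ∈ (Finset.univ.filter fun a => z a < x)ᶜ,
        d a * weight (lam / 2 ^ j) (d a) * (1 + z a / γ) ^ 2 ≤
      e * ∑ a, d a * weight (lam / 2 ^ j) (d a) := fun j hj =>
    sum_bad_le (regret_term_le_excessCoeff hd hlam hj a₀) hc0 (hRpos _ (by positivity)) hW
  have hmain := abs_regret_sub_le (Finset.univ.filter fun a => z a < x) (d := d)
    (y := fun a => z a / γ) (n := fun a => (pulls A a T ω : ℝ)) hd
    (fun a => div_nonneg (hz a) hγ.le) (fun a => Nat.cast_nonneg _) hlam hV he he'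
    ⟨a₀, by simpa using hz0⟩ (fun a ha => hgood a (Finset.mem_filter.1 ha).2)
    (by exact_mod_cast sum_pulls A T ω) hF (by simpa using hKe)
    (fun a => (one_le_mul_weight_levelStar hK hT μ hσ hγ a).trans
      (mul_le_mul_of_nonneg_right hsmall (weight_pos hlam (hd a)).le))
    (fun a => le_one_add_mul_weight hV (hd a) (hVall a).1)
    (fun a ha => mul_weight_le_of_level (hn0 a) hV (hd a) (by linarith)
      (hlower a (Finset.mem_filter.1 ha).2))
    (by
      rw [← hF]
      exact sum_bad_le (pulls_term_le_excessCoeff hd hlam _ a₀) hc0 (by rw [hF]; exact hTr) hW)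
    (by simpa using hbadR 0 (by simp)) hj1 hj2 (hbadR j hj)
  have hR := hRpos lam hlam
  rw [pseudoRegret_eq hσ hγ, regStar_eq hK hT μ hσ hγ, mul_div_mul_left _ _ hσγ.ne',
    div_sub_one hR.ne', abs_div, abs_of_pos hR, div_le_iff₀ hR]
  exact hmain

/-- Markov's inequality for a weighted sum of the excesses of the arms. -/
lemma IsAdaptive.measure_sum_excess_ge {Ω : Type*} {K : ℕ} {mΩ : MeasurableSpace Ω}
    {P : Measure Ω} [IsProbabilityMeasure P] {T : ℕ} {ξ : ℕ → Ω → ℝ} {A : ℕ → Ω → Fin K}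
    {ℱ : Filtration ℕ mΩ} (h : IsAdaptive T ξ A ℱ P) {γ x : ℝ} (hγ : 1 ≤ γ) (hx : 4 ≤ x)
    {c : Fin K → ℝ} (hc : ∀ a, 0 ≤ c a) {M : ℝ} (hM : ∑ a, c a ≤ M) :
    P.real {ω | γ⁻¹ ≤ ∑ a, c a * excess γ x (maxDev T ξ A a ω)} ≤
      γ * (M * (512 * (Nat.log 2 T + 1 : ℕ) * Real.exp (-(x ^ 2 / 8)))) := by
  set D := 512 * ((Nat.log 2 T + 1 : ℕ) : ℝ) * Real.exp (-(x ^ 2 / 8)) with hD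
  have hD0 : 0 ≤ D := by positivity
  have hM0 : 0 ≤ M := (Finset.sum_nonneg fun a _ => hc a).trans hM
  have hγ0 : 0 < γ := by linarith
  have hmeas : ∀ a, Measurable fun ω => c a * excess γ x (maxDev T ξ A a ω) := fun a =>
    ((measurable_excess γ x).comp (h.measurable_maxDev a)).const_mul (c a)
  have hint : ∫⁻ ω, ENNReal.ofReal (∑ a, c a * excess γ x (maxDev T ξ A a ω)) ∂P ≤
      ENNReal.ofReal (M * D) := by
    have h1 : ∀ ω, ENNReal.ofReal (∑ a, c a * excess γ x (maxDev T ξ A a ω)) =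
        ∑ a, ENNReal.ofReal (c a) * ENNReal.ofReal (excess γ x (maxDev T ξ A a ω)) := fun ω => by
      rw [ENNReal.ofReal_sum_of_nonneg fun a _ => mul_nonneg (hc a) (excess_nonneg _ _ _)]
      exact Finset.sum_congr rfl fun a _ => ENNReal.ofReal_mul (hc a)
    have hm : ∀ a, Measurable fun ω => ENNReal.ofReal (excess γ x (maxDev T ξ A a ω)) := fun a =>
      ((measurable_excess γ x).comp (h.measurable_maxDev a)).ennreal_ofReal
    simp_rw [h1]
    rw [lintegral_finsetSum _ fun a _ => (hm a).const_mul _]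
    simp_rw [lintegral_const_mul _ (hm _)]
    calc _ ≤ ∑ a, ENNReal.ofReal (c a) * ENNReal.ofReal D :=
          Finset.sum_le_sum fun a _ => mul_le_mul_right (h.lintegral_excess_le a hγ hx) _
      _ = ENNReal.ofReal ((∑ a, c a) * D) := by
          rw [← Finset.sum_mul, ← ENNReal.ofReal_sum_of_nonneg fun a _ => hc a,
            ← ENNReal.ofReal_mul (Finset.sum_nonneg fun a _ => hc a)]
      _ ≤ _ := ENNReal.ofReal_le_ofReal (mul_le_mul_of_nonneg_right hM hD0)
  rw [measureReal_def]
  refine ENNReal.toReal_le_of_le_ofReal (by positivity) ?_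
  have hsub : {ω | γ⁻¹ ≤ ∑ a, c a * excess γ x (maxDev T ξ A a ω)} ⊆
      {ω | ENNReal.ofReal γ⁻¹ ≤ ENNReal.ofReal (∑ a, c a * excess γ x (maxDev T ξ A a ω))} :=
    fun ω hω => ENNReal.ofReal_le_ofReal hω
  refine (measure_mono hsub).trans ((meas_ge_le_lintegral_div
    (Finset.measurable_fun_sum _ fun a _ => hmeas a).ennreal_ofReal.aemeasurable
    (by simpa using hγ0) ENNReal.ofReal_ne_top).trans ?_)
  refine (ENNReal.div_le_div_right hint _).trans_eq ?_
  rw [← ENNReal.ofReal_div_of_pos (by positivity), div_inv_eq_mul, mul_comm]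

/-- The failure probability is of order `γ ^ (-100)` for the deviation
`40 (√(log γ) + √(log log T))`. -/
lemma failure_prob_le {γ x s₁ s₂ : ℝ} {T : ℕ} (hγ : 1 ≤ γ) (hT : T ≠ 0)
    (hlog : 1 ≤ Real.log T) (hs₁ : s₁ = √(Real.log γ)) (hs₂ : s₂ = √(Real.log (Real.log T)))
    (hx : x = 40 * (s₁ + s₂)) :
    γ * (((Nat.log 2 T + 1 : ℕ) + 2 : ℝ) *
      (512 * (Nat.log 2 T + 1 : ℕ) * Real.exp (-(x ^ 2 / 8)))) ≤ 7680 * γ ^ (-100 : ℤ) := by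
  set l := Real.log T with hl
  have hγ0 : 0 < γ := by linarith
  have hL : ((Nat.log 2 T + 1 : ℕ) : ℝ) ≤ 3 * l := by
    have h1 : ((2 : ℝ) ^ Nat.log 2 T) ≤ T := by exact_mod_cast Nat.pow_log_le_self 2 hT
    have h2 := Real.log_le_log (by positivity) h1
    rw [Real.log_pow] at h2
    have h3 : (1 / 2 : ℝ) ≤ Real.log 2 := by linarith [Real.log_two_gt_d9]
    have h4 : (Nat.log 2 T : ℝ) * (1 / 2) ≤ Nat.log 2 T * Real.log 2 := by gcongr
    push_cast
    linarith
  have hexp : Real.exp (-(x ^ 2 / 8)) ≤ (γ ^ 101)⁻¹ * (l ^ 2)⁻¹ := by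
    have hlγ : 0 ≤ Real.log γ := Real.log_nonneg hγ
    have hll : 0 ≤ Real.log l := Real.log_nonneg hlog
    have h1 : s₁ ^ 2 = Real.log γ := by rw [hs₁, Real.sq_sqrt hlγ]
    have h2 : s₂ ^ 2 = Real.log l := by rw [hs₂, Real.sq_sqrt hll]
    have h3 : 0 ≤ s₁ * s₂ := by rw [hs₁, hs₂]; positivity
    -- One of the 101 powers of `γ` pays for Markov's inequality at threshold `γ⁻¹`; the two powers
    -- of `log T` pay for the grid levels and the dyadic scales.
    have h4 : 101 * Real.log γ + 2 * Real.log l ≤ x ^ 2 / 8 := by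
      rw [hx]; nlinarith
    calc Real.exp (-(x ^ 2 / 8)) ≤ Real.exp (-(101 * Real.log γ + 2 * Real.log l)) :=
          Real.exp_le_exp.2 (by linarith)
      _ = (γ ^ 101)⁻¹ * (l ^ 2)⁻¹ := by
          rw [Real.exp_neg, Real.exp_add, ← Nat.cast_ofNat (n := 101), ← Nat.cast_ofNat (n := 2),
            Real.exp_nat_mul, Real.exp_nat_mul, Real.exp_log hγ0, Real.exp_log (by linarith),
            mul_inv]
  have hl0 : 0 < l := by linarith
  calc _ ≤ γ * ((3 * l + 2 * l) * (512 * (3 * l) * ((γ ^ 101)⁻¹ * (l ^ 2)⁻¹))) := by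
        gcongr
        linarith
    _ = 7680 * γ ^ (-100 : ℤ) := by
        rw [zpow_neg]
        have : γ ^ (100 : ℤ) = γ ^ 100 := by norm_cast
        rw [this]
        field_simp
        ring

lemma one_le_log_log {T : ℕ} (hT : 27 ≤ T) : 1 ≤ Real.log (Real.log T) ∧ 1 ≤ Real.log T := by
  have h3 : Real.exp 1 ≤ 3 := by linarith [Real.exp_one_lt_d9]
  have hT' : (27 : ℝ) ≤ T := by exact_mod_cast hT
  have h1 : (3 : ℝ) ≤ Real.log T := by
    rw [Real.le_log_iff_exp_le (by linarith)]
    calc Real.exp 3 = Real.exp 1 ^ 3 := by rw [← Real.exp_nat_mul]; norm_num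
      _ ≤ 3 ^ 3 := by gcongr
      _ ≤ T := by linarith
  refine ⟨?_, by linarith⟩
  rw [Real.le_log_iff_exp_le (by linarith)]
  linarith

end UCB

theorem mainTheorem3 :
    ∃ C : ℝ, 0 < C ∧
      ∀ (T K : ℕ) (μ : Fin K → ℝ) (σ γ : ℝ),
        0 < T → 0 < σ → 0 < γ →
        (∃ a, 0 < UCB.gap μ a) →
        UCB.err T (UCB.gap μ) σ γ ≤ 1 / C →
        ∀ (Ω : Type*) (mΩ : MeasurableSpace Ω) (P : MeasureTheory.Measure Ω)
          (_ : MeasureTheory.IsProbabilityMeasure P)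
          (ξ : ℕ → Ω → ℝ) (A : ℕ → Ω → Fin K) (ℱ : MeasureTheory.Filtration ℕ mΩ),
          UCB.IsGaussianNoise T ξ P →
          UCB.IsUCB1 T μ σ γ ξ A ℱ P →
          P.real {ω | C * UCB.err T (UCB.gap μ) σ γ ≤
              |UCB.pseudoRegret T μ A ω / UCB.regStar T (UCB.gap μ) σ γ - 1|}
            ≤ C * γ ^ (-100 : ℤ) := by
  -- With `e = 40 * E` the deterministic bound is `14 * e = 560 * E`, and the failure constant is
  -- 7680; 100000 exceeds both and ensures `e ≤ 1 / 20`.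
  refine ⟨100000, by norm_num, ?_⟩
  intro T K μ σ γ hT hσ hγ hgap herr Ω mΩ P _ ξ A ℱ hξ hA
  have hK : 0 < K := by obtain ⟨a, -⟩ := hgap; exact a.pos
  have hTr : (0 : ℝ) < T := by exact_mod_cast hT
  obtain ⟨a₀, ha₀⟩ := UCB.exists_gap_eq_zero hK μ
  set E := UCB.err T (UCB.gap μ) σ γ with hE
  set s₁ := √(Real.log γ) with hs₁
  set s₂ := √(Real.log (Real.log T)) with hs₂
  have hEdef : E = (s₁ + s₂) / γ + (K : ℝ) / T + ‖fun a => UCB.gap μ a / σ‖ ^ 2 / γ ^ 2 := rfl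
  have hs₁0 : 0 ≤ s₁ := Real.sqrt_nonneg _
  have hs₂0 : 0 ≤ s₂ := Real.sqrt_nonneg _
  have h1 : 0 ≤ (s₁ + s₂) / γ := by positivity
  have h2 : 0 ≤ (K : ℝ) / T := by positivity
  have h3 : 0 ≤ ‖fun a => UCB.gap μ a / σ‖ ^ 2 / γ ^ 2 := by positivity
  have hT27 : 27 ≤ T := by
    have h4 : (K : ℝ) / T ≤ 1 / 100000 := by linarith
    have hK1 : (1 : ℝ) ≤ K := by exact_mod_cast hK
    rw [div_le_iff₀ hTr] at h4
    have : (27 : ℝ) ≤ T := by linarith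
    exact_mod_cast this
  obtain ⟨hll, hlog⟩ := UCB.one_le_log_log hT27
  have hs₂1 : 1 ≤ s₂ := Real.one_le_sqrt.2 hll
  -- As `T ≥ 27` forces `s₂ ≥ 1`, the error dominates `γ⁻¹`. This gives `γ ≥ 1` and makes the Markov
  -- threshold `γ⁻¹` admissible.
  have hγE : γ⁻¹ ≤ (s₁ + s₂) / γ := by
    rw [inv_eq_one_div]
    gcongr
    linarith
  have hγ1 : 1 ≤ γ := by
    have h4 : γ⁻¹ ≤ 1 := by linarith
    rwa [inv_le_one₀ hγ] at h4
  have hEpos : 0 < E := by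
    have : 0 < γ⁻¹ := inv_pos.2 hγ
    linarith
  have hxE : 40 * (s₁ + s₂) / γ ≤ 40 * E := by
    rw [mul_div_assoc]; linarith
  set x := 40 * (s₁ + s₂) with hx
  have hd : ∀ a, 0 ≤ UCB.gap μ a / (σ * γ) := fun a =>
    div_nonneg (UCB.gap_nonneg μ a) (by positivity)
  have hlam := UCB.levelStar_pos hK hT μ hσ hγ
  refine le_trans (MeasureTheory.measureReal_mono (fun ω hω => ?_))
    (((hA.isAdaptive hξ).measure_sum_excess_ge hγ1 (x := x) (by linarith)
      (UCB.excessCoeff_nonneg hd hlam (Nat.log 2 T + 1) a₀)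
      (UCB.sum_excessCoeff_le _ _ _ a₀)).trans
    ((UCB.failure_prob_le hγ1 hT.ne' hlog hs₁ hs₂ hx).trans ?_))
  · by_contra hcon
    have hW := (not_le.1 (show ¬ γ⁻¹ ≤ _ from hcon)).le
    have := hA.abs_regret_div_sub_one_le hσ hγ hT hgap ha₀ (e := 40 * E) (by linarith) hxE
      (by linarith) (hW.trans (by linarith))
    have h5 : 100000 * E ≤
      |UCB.pseudoRegret T μ A ω / UCB.regStar T (UCB.gap μ) σ γ - 1| := hω
    linarith
  · gcongr
    norm_num
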